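/- Let $0\le\alpha<1$, let $m\ge 1$ be an integer, and let $f$ be a real- or complex-valued function that is locally integrable on $[0,\infty)$ and $m$ times continuously differentiable on $(0,\infty)$. Suppose that, as $t\to0^+$, $$f(t)\sim\sum_{j=0}^{\infty}a_j\,t^{j-\alpha},$$ and that this asymptotic expansion can be differentiated termwise $m$ times, i.e. for $s=0,1,\dots,m$, as $t\to 0^+$, $$f^{(s)}(t)\sim\sum_{j\ge0}a_j(j-\alpha)(j-\alpha-1)\cdots(j-\alpha-s+1)\,t^{j-\alpha-s}.$$ If $\alpha=0$, $f$ is taken to be continuous at $0$ from the right (so that $f(0)=a_0$). Put $\tilde f(t)=\dfrac{f(t)-a_0t^{-\alpha}}{t}$ for $t>0$, and assume that each of the (improper) integrals $$\int_1^\infty \tilde f^{(s)}(t)\,e^{i\omega t}\,dt,\qquad s=0,1,\dots,m,$$ converges uniformly for all sufficiently large $\omega$. For $h$ locally integrable on $(0,\infty)$, the Hadamard finite-part integral over $(0,\infty)$ is $$\mathrm{f.p.}\!\int_0^\infty h(t)\,dt=\mathrm{f.p.}\!\int_0^b h(t)\,dt+\lim_{R\to\infty}\int_b^R h(t)\,dt,\qquad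 b>0,$$ where $\mathrm{f.p.}\int_0^b h(t)\,dt$ is the limit as $\varepsilon\to0^+$ of $\int_\varepsilon^b h(t)\,dt$ after subtraction of a finite linear combination of divergent terms $\varepsilon^{-\beta}(\log\varepsilon)^k$ with $k\in\{0,1,2,\dots\}$ and either $\beta>0$, or $\beta=0$ and $k\ge1$ (the value does not depend on $b$ or on the choice of the subtracted terms). Then $\mathrm{f.p.}\int_0^\infty e^{i\omega t}\frac{f(t)}{t}\,dt$ exists for all sufficiently large $\omega$ and, as $\omega\to\infty$, $$\mathrm{f.p.}\!\int_0^\infty e^{i\omega t}\frac{f(t)}{t}\,dt=\frac{e^{\frac{\pi}{2}(2-\alpha)i}\,\omega^{\alpha}}{\alpha}\,\Gamma(1-\alpha)\,a_0+\sum_{\ell=1}^{m}a_\ell\, e^{\frac{\pi}{2}(\ell-\alpha)i}\,\frac{\Gamma(\ell-\alpha)}{\omega^{\ell-\alpha}}+o(\omega^{-m})\qquad\text{if }0<\alpha<1,$$ $$\mathrm{f.p.}\!\int_0^\infty e^{i\omega t}\frac{f(t)}{t}\,dt=\Big(\frac{i\pi}{2}-\gamma-\log\omega\Big)f(0)+\sum_{\ell=1}^{m}a_\ell\,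 e^{\frac{\pi\ell}{2}i}\,\frac{(\ell-1)!}{\omega^{\ell}}+o(\omega^{-m})\qquad\text{if }\alpha=0,$$ where $\gamma$ is Euler's constant. -/

import Mathlib

open Filter Topology Asymptotics MeasureTheory Set

/-- The divergent gauge functions `ε ↦ ε ^ (-β) * (log ε) ^ k`, `p = (β, k)`, that are discarded in
a Hadamard finite part. -/
noncomputable def hadamardGauge (p : ℝ × ℕ) (ε : ℝ) : ℝ :=
  ε ^ (-p.1) * Real.log ε ^ p.2

/-- `I` is the Hadamard finite part of `∫₀ᵇ h(t) dt`: after removal of a finite linear combination of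
the divergent terms `ε ^ (-β) * (log ε) ^ k` (`β > 0`, or `β = 0` and `k ≥ 1`), the integral over
`(ε, b)` tends to `I` as `ε → 0⁺`. -/
def HasFinitePartZero (h : ℝ → ℂ) (b : ℝ) (I : ℂ) : Prop :=
  (∀ ε : ℝ, 0 < ε → IntervalIntegrable h volume ε b) ∧
  ∃ (s : Finset (ℝ × ℕ)) (c : ℝ × ℕ → ℂ),
    (∀ p ∈ s, 0 < p.1 ∨ (p.1 = 0 ∧ 1 ≤ p.2)) ∧
    Tendsto (fun ε : ℝ => (∫ t in ε..b, h t) - ∑ p ∈ s, c p * (hadamardGauge p ε : ℂ))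
      (𝓝[>] 0) (𝓝 I)

/-- The (possibly only conditionally convergent) integral `∫_b^∞ h(t) dt = lim_{R → ∞} ∫_b^R h(t) dt`
exists and equals `J`. -/
def HasImproperIntegral (h : ℝ → ℂ) (b : ℝ) (J : ℂ) : Prop :=
  (∀ R : ℝ, b ≤ R → IntervalIntegrable h volume b R) ∧
  Tendsto (fun R : ℝ => ∫ t in b..R, h t) atTop (𝓝 J)

/-- `L` is the Hadamard finite part of `∫₀^∞ h(t) dt`: the finite part over `(0, b)` plus the
improper integral over `(b, ∞)`, for some `b > 0` (the value does not depend on `b`). -/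
def HasHadamardFinitePart (h : ℝ → ℂ) (L : ℂ) : Prop :=
  ∃ b : ℝ, 0 < b ∧ ∃ I J : ℂ, HasFinitePartZero h b I ∧ HasImproperIntegral h b J ∧ L = I + J

open Classical in
/-- The value of the Hadamard finite-part integral of `h` over `(0, ∞)` (`0` if there is none). -/
noncomputable def hadamardFinitePart (h : ℝ → ℂ) : ℂ :=
  if H : ∃ L, HasHadamardFinitePart h L then H.choose else 0

theorem hadamardGauge_isLittleO {p q : ℝ × ℕ} (hqp : q.1 < p.1 ∨ (q.1 = p.1 ∧ q.2 < p.2)) :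
    hadamardGauge q =o[𝓝[>] (0 : ℝ)] hadamardGauge p := by
  have hlog : Tendsto (fun ε : ℝ => |Real.log ε|) (𝓝[>] 0) atTop :=
    tendsto_abs_atBot_atTop.comp Real.tendsto_log_nhdsGT_zero
  rcases hqp with h | ⟨h1, h2⟩
  · have hO : (fun ε : ℝ => ε ^ (-p.1)) =O[𝓝[>] (0 : ℝ)] hadamardGauge p := by
      refine IsBigO.of_bound 1 ?_
      filter_upwards [hlog.eventually_ge_atTop 1] with ε hε
      rw [one_mul, hadamardGauge, norm_mul, norm_pow, Real.norm_eq_abs (Real.log ε)]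
      exact le_mul_of_one_le_right (norm_nonneg _) (one_le_pow₀ hε)
    have hl : (fun ε : ℝ => Real.log ε ^ q.2) =o[𝓝[>] (0 : ℝ)] fun ε => ε ^ (q.1 - p.1) := by
      have := isLittleO_abs_log_rpow_rpow_nhdsGT_zero (s := q.1 - p.1) (q.2 : ℝ) (by linarith)
      refine IsLittleO.of_norm_left (this.congr_left fun ε => ?_)
      rw [Real.rpow_natCast, norm_pow, Real.norm_eq_abs]
    refine IsLittleO.trans_isBigO ?_ hO
    refine ((isBigO_refl (fun ε : ℝ => ε ^ (-q.1)) _).mul_isLittleO hl).congr' .rfl ?_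
    filter_upwards [self_mem_nhdsWithin] with ε hε
    rw [← Real.rpow_add hε]
    congr 1
    ring
  · unfold hadamardGauge
    rw [h1]
    refine (isBigO_refl (fun ε : ℝ => ε ^ (-p.1)) _).mul_isLittleO ?_
    have := (isLittleO_pow_pow_atTop_of_lt (𝕜 := ℝ) h2).comp_tendsto hlog
    refine IsLittleO.of_norm_norm (this.congr ?_ ?_) <;> intro ε <;> simp

/-- A combination of divergent gauge functions that converges is zero in the limit. -/
theorem hadamardGauge_tendsto_unique {s : Finset (ℝ × ℕ)} {c : ℝ × ℕ → ℂ} {L : ℂ}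
    (hs : ∀ p ∈ s, 0 < p.1 ∨ (p.1 = 0 ∧ 1 ≤ p.2))
    (h : Tendsto (fun ε : ℝ => ∑ p ∈ s, c p * (hadamardGauge p ε : ℂ)) (𝓝[>] 0) (𝓝 L)) :
    L = 0 := by
  classical
  have hfil : ∀ ε : ℝ, ∑ p ∈ s, c p * (hadamardGauge p ε : ℂ) =
      ∑ p ∈ s.filter (fun p => c p ≠ 0), c p * (hadamardGauge p ε : ℂ) := by
    intro ε
    rw [Finset.sum_filter]
    refine Finset.sum_congr rfl fun p _ => ?_
    by_cases hp : c p = 0 <;> simp [hp]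
  simp only [hfil] at h
  rcases (s.filter (fun p => c p ≠ 0)).eq_empty_or_nonempty with he | hne
  · rw [he] at h
    simpa using tendsto_nhds_unique h (by simp)
  · obtain ⟨p, hp, hmax⟩ := Finset.exists_max_image _ (fun p : ℝ × ℕ => toLex p) hne
    obtain ⟨hps, hcp⟩ := Finset.mem_filter.1 hp
    have hC : ∀ q : ℝ × ℕ, (q.1 < p.1 ∨ (q.1 = p.1 ∧ q.2 < p.2)) →
        (fun ε => (hadamardGauge q ε : ℂ)) =o[𝓝[>] (0 : ℝ)] fun ε => (hadamardGauge p ε : ℂ) :=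
      fun q hq => IsLittleO.of_norm_norm
        ((hadamardGauge_isLittleO hq).norm_norm.congr (fun _ => by simp) (fun _ => by simp))
    have h1 : (fun _ : ℝ => (1 : ℂ)) =o[𝓝[>] (0 : ℝ)] fun ε => (hadamardGauge p ε : ℂ) := by
      have := hC (0, 0) (by
        rcases hs p hps with h | ⟨h, h'⟩
        · exact Or.inl h
        · exact Or.inr ⟨h.symm, h'⟩)
      simpa [hadamardGauge] using this
    have h2 := (h.isBigO_one ℂ).trans_isLittleO h1
    have h3 : (fun ε : ℝ => ∑ q ∈ (s.filter (fun p => c p ≠ 0)).erase p,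
        c q * (hadamardGauge q ε : ℂ)) =o[𝓝[>] (0 : ℝ)] fun ε => (hadamardGauge p ε : ℂ) := by
      refine IsLittleO.fun_sum fun q hq => (hC q ?_).const_mul_left _
      obtain ⟨hqp, hq⟩ := Finset.mem_erase.1 hq
      have hlt : toLex q < toLex p := lt_of_le_of_ne (hmax q hq) (by simpa using hqp)
      simpa [Prod.Lex.toLex_lt_toLex] using hlt
    have h4 : (fun ε : ℝ => c p * (hadamardGauge p ε : ℂ)) =o[𝓝[>] (0 : ℝ)]
        fun ε => (hadamardGauge p ε : ℂ) := by
      refine (h2.sub h3).congr_left fun ε => ?_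
      rw [← Finset.add_sum_erase _ _ hp]
      ring
    rw [isLittleO_const_mul_left_iff hcp] at h4
    have h5 : ∀ᶠ ε in 𝓝[>] (0 : ℝ), (hadamardGauge p ε : ℂ) = 0 := by
      filter_upwards [h4.bound (half_pos one_pos)] with ε hε
      have := norm_nonneg (hadamardGauge p ε : ℂ)
      exact norm_eq_zero.1 (by linarith)
    obtain ⟨ε, hε, hε'⟩ := ((h1.bound one_pos).and h5).exists
    rw [hε'] at hε
    norm_num at hε

/-- The Hadamard finite part is unique; in particular it does not depend on `b`. -/
theorem HasHadamardFinitePart.unique {h : ℝ → ℂ} {L L' : ℂ}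
    (hL : HasHadamardFinitePart h L) (hL' : HasHadamardFinitePart h L') : L = L' := by
  classical
  obtain ⟨b, hb, I, J, ⟨hi, s, c, hs, hI⟩, ⟨-, hJ⟩, rfl⟩ := hL
  obtain ⟨b', hb', I', J', ⟨hi', s', c', hs', hI'⟩, ⟨-, hJ'⟩, rfl⟩ := hL'
  have hii : ∀ x y : ℝ, 0 < x → 0 < y → IntervalIntegrable h volume x y :=
    fun x y hx hy => (hi x hx).trans (hi y hy).symm
  have hJJ : J - J' = ∫ t in b..b', h t := by
    refine tendsto_nhds_unique (hJ.sub hJ') (tendsto_const_nhds.congr' ?_)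
    filter_upwards [eventually_gt_atTop 0] with R hR
    rw [← intervalIntegral.integral_add_adjacent_intervals (hii b b' hb hb') (hii b' R hb' hR)]
    ring
  have hd : Tendsto (fun ε : ℝ => ∑ p ∈ s ∪ s', ((if p ∈ s' then c' p else 0) -
      (if p ∈ s then c p else 0)) * (hadamardGauge p ε : ℂ)) (𝓝[>] 0)
      (𝓝 (I - I' + ∫ t in b..b', h t)) := by
    refine ((hI.sub hI').add_const (∫ t in b..b', h t)).congr' ?_
    filter_upwards [self_mem_nhdsWithin] with ε hε
    rw [← intervalIntegral.integral_add_adjacent_intervals (hi ε hε) (hii b b' hb hb')]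
    simp only [sub_mul, Finset.sum_sub_distrib, ite_mul, zero_mul]
    rw [← Finset.sum_filter, ← Finset.sum_filter, Finset.filter_mem_eq_inter,
      Finset.filter_mem_eq_inter, Finset.union_inter_cancel_right, Finset.union_inter_cancel_left]
    ring
  have h0 := hadamardGauge_tendsto_unique (fun p hp => by
    rcases Finset.mem_union.1 hp with hp | hp
    · exact hs p hp
    · exact hs' p hp) hd
  rw [← hJJ] at h0
  linear_combination h0

theorem HasHadamardFinitePart.eq {h : ℝ → ℂ} {L : ℂ} (hL : HasHadamardFinitePart h L) :
    hadamardFinitePart h = L := by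
  have H : ∃ L, HasHadamardFinitePart h L := ⟨L, hL⟩
  rw [hadamardFinitePart, dif_pos H]
  exact H.choose_spec.unique hL

/-- The Poincaré asymptotic expansion `g(t) ~ ∑_{j ≥ 0} c_j t ^ (j - β)` as `t → 0⁺`. -/
def HasExpansionAtZero (g : ℝ → ℂ) (c : ℕ → ℂ) (β : ℝ) : Prop :=
  ∀ N : ℕ, (fun t : ℝ => g t - ∑ j ∈ Finset.range (N + 1), c j * ((t ^ ((j : ℝ) - β) : ℝ) : ℂ))
    =o[𝓝[>] (0 : ℝ)] fun t : ℝ => t ^ ((N : ℝ) - β)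

/-- The expansion `f(t) ~ ∑_{j ≥ 0} a_j t ^ (j - α)` as `t → 0⁺` holds and can be differentiated
termwise `m` times: for every `s ≤ m`,
`f⁽ˢ⁾(t) ~ ∑_j a_j (j - α)(j - α - 1) ⋯ (j - α - s + 1) t ^ (j - α - s)`. -/
def HasDifferentiableExpansionAtZero (f : ℝ → ℂ) (a : ℕ → ℂ) (α : ℝ) (m : ℕ) : Prop :=
  ∀ s : ℕ, s ≤ m → HasExpansionAtZero (iteratedDeriv s f)
    (fun j => a j * ((∏ k ∈ Finset.range s, ((j : ℝ) - α - (k : ℝ)) : ℝ) : ℂ)) (α + s)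

/-- The function `(f(t) - a₀ t ^ (-α)) / t`. -/
noncomputable def fTilde (f : ℝ → ℂ) (a₀ : ℂ) (α : ℝ) (t : ℝ) : ℂ :=
  (f t - a₀ * ((t ^ (-α) : ℝ) : ℂ)) / (t : ℂ)

/-- The improper integral `∫_1^∞ g(t) e^{iωt} dt` converges uniformly for all sufficiently
large `ω`. -/
def FourierTailConvergesUniformly (g : ℝ → ℂ) : Prop :=
  ∃ (Ω : ℝ) (J : ℝ → ℂ), TendstoUniformlyOn
    (fun (R ω : ℝ) => ∫ t in (1 : ℝ)..R, g t * Complex.exp (Complex.I * (ω : ℂ) * (t : ℂ)))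
    J atTop (Ici Ω)

/-!
Put `g = fTilde f (a 0) α`, so that `f(t) / t = a₀ t ^ (-α - 1) + g(t)` on `(0, ∞)`. The finite part
splits accordingly into that of `a₀ e^{iωt} t ^ (-α - 1)`, which produces the leading term, and the
convergent integral of `e^{iωt} g(t)`, which produces the sum over `l`. Throughout, `e^{iωt}` is
written as `e^{-rt}` with `r = -iω`.

For `g`, let `p(t) = ∑_{l=1}^m a_l t ^ (l - 1 - α)`. The derivatives of `g - p` of order `k ≤ m` are
`O(t ^ (m - α - k))` at the origin (`isBigO_iteratedDeriv_fTilde`), so `m` integrations by parts of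
`e^{-rt} (g - p)` on `(0, 1]` leave boundary terms at `1` only and a remainder
`r ^ (-m) ∫_0^1 e^{-rt} (g - p)⁽ᵐ⁾`. Likewise `m` integrations by parts of `e^{-rt} g` on `[1, ∞)`
leave boundary terms at `1` only: those at infinity vanish because the integrals converge for more
than one frequency (`tendsto_zero_of_tendsto_two_frequencies`). The integral of `e^{-rt} p` over
`(0, 1]` is computed from Euler's integral `∫_0^∞ e^{-rt} t ^ q dt = Γ(q + 1) r ^ (-q - 1)` for
`Re r > 0`: the part over `(1, ∞)` is integrated by parts `m` times, after which `r` may tend to the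
imaginary axis (`integral_zero_one_exp_mul_rpow`). All boundary terms at `1` cancel, and the
remainders are `r ^ (-m)` times Fourier integrals that tend to `0`, by the Riemann-Lebesgue lemma
and, for the tail of `g⁽ᵐ⁾`, by the uniformity of its convergence
(`IsDerivChain.fourier_isLittleO`).

For the power `t ^ (-α - 1)`, one integration by parts reduces the case `0 < α < 1` to Euler's
integral with exponent `-α`, and gives `(1 - Γ(1 - α) r ^ α) / α` for the integral of
`(e^{-rt} - 𝟙_{t ≤ 1}) t ^ (-α - 1)` (`regularizedPowIntegral_of_pos`). That integral is continuous
as `α → 0⁺`, and its limit is `-d/dα (Γ(1 - α) r ^ α)` at `α = 0`, that is `-γ - log r`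
(`regularizedPowIntegral_zero`).
-/

/-! ### Derivatives and Laplace transforms of powers -/

/-- The `k`-th derivative of `t ↦ t ^ q` on `(0, ∞)`, namely
`q (q - 1) ⋯ (q - k + 1) t ^ (q - k)`. -/
noncomputable def powDeriv (q : ℝ) (k : ℕ) (t : ℝ) : ℝ :=
  (∏ i ∈ Finset.range k, (q - i)) * t ^ (q - k)

theorem powDeriv_zero (q t : ℝ) : powDeriv q 0 t = t ^ q := by
  simp [powDeriv]

theorem hasDerivAt_powDeriv (q : ℝ) (k : ℕ) {t : ℝ} (ht : 0 < t) :
    HasDerivAt (powDeriv q k) (powDeriv q (k + 1) t) t := by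
  have h := (Real.hasDerivAt_rpow_const (p := q - k) (Or.inl ht.ne')).const_mul
    (∏ i ∈ Finset.range k, (q - i))
  unfold powDeriv
  refine h.congr_deriv ?_
  rw [Finset.prod_range_succ]
  push_cast
  rw [← sub_sub]
  ring

theorem hasDerivAt_ofReal_powDeriv (q : ℝ) (k : ℕ) {t : ℝ} (ht : 0 < t) :
    HasDerivAt (fun t : ℝ => (powDeriv q k t : ℂ)) (powDeriv q (k + 1) t : ℂ) t :=
  (hasDerivAt_powDeriv q k ht).ofReal_comp

theorem continuousOn_ofReal_powDeriv (q : ℝ) (k : ℕ) :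
    ContinuousOn (fun t : ℝ => (powDeriv q k t : ℂ)) (Ioi 0) := fun _ ht =>
  (hasDerivAt_ofReal_powDeriv q k ht).continuousAt.continuousWithinAt

theorem norm_exp_neg_mul_ofReal (r : ℂ) (t : ℝ) :
    ‖Complex.exp (-(r * t))‖ = Real.exp (-(r.re * t)) := by
  rw [Complex.norm_exp]
  simp

theorem norm_exp_neg_mul_ofReal_le_one {r : ℂ} (hr : 0 ≤ r.re) {t : ℝ} (ht : 0 ≤ t) :
    ‖Complex.exp (-(r * t))‖ ≤ 1 := by
  rw [norm_exp_neg_mul_ofReal, Real.exp_le_one_iff]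
  nlinarith [mul_nonneg hr ht]

theorem integrableOn_rpow_mul_exp_neg {q c : ℝ} (hq : -1 < q) (hc : 0 < c) :
    IntegrableOn (fun t : ℝ => t ^ q * Real.exp (-(c * t))) (Ioi 0) := by
  have := integrableOn_rpow_mul_exp_neg_mul_rpow hq one_pos hc
  simpa [Real.rpow_one] using this

theorem measurable_exp_neg_mul_rpow (r : ℂ) (q : ℝ) :
    Measurable (fun t : ℝ => Complex.exp (-(r * t)) * ((t ^ q : ℝ) : ℂ)) := by
  fun_prop

theorem integrableOn_exp_neg_mul_rpow {q : ℝ} (hq : -1 < q) {r : ℂ} (hr : 0 < r.re) :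
    IntegrableOn (fun t : ℝ => Complex.exp (-(r * t)) * ((t ^ q : ℝ) : ℂ)) (Ioi 0) := by
  refine Integrable.mono' (integrableOn_rpow_mul_exp_neg hq hr)
    (measurable_exp_neg_mul_rpow r q).aestronglyMeasurable ?_
  filter_upwards [ae_restrict_mem measurableSet_Ioi] with t ht
  rw [norm_mul, norm_exp_neg_mul_ofReal, Complex.norm_real, Real.norm_of_nonneg
    (Real.rpow_nonneg (le_of_lt ht) _), mul_comm]

/-- The Laplace transform of a power is holomorphic on the right half-plane. -/
theorem differentiableOn_laplace_rpow {q : ℝ} (hq : -1 < q) :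
    DifferentiableOn ℂ
      (fun r : ℂ => ∫ t in Ioi (0 : ℝ), Complex.exp (-(r * t)) * ((t ^ q : ℝ) : ℂ))
      {r : ℂ | 0 < r.re} := by
  intro r hr
  have hr : 0 < r.re := hr
  have hs : {z : ℂ | r.re / 2 < z.re} ∈ 𝓝 r :=
    (isOpen_lt continuous_const Complex.continuous_re).mem_nhds (by simp; linarith)
  refine DifferentiableAt.differentiableWithinAt (HasDerivAt.differentiableAt
    (hasDerivAt_integral_of_dominated_loc_of_deriv_le
      (μ := volume.restrict (Ioi (0 : ℝ)))
      (F' := fun z t => -(t : ℂ) * Complex.exp (-(z * t)) * ((t ^ q : ℝ) : ℂ))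
      (bound := fun t => t ^ (q + 1) * Real.exp (-(r.re / 2 * t))) hs ?_ ?_ ?_ ?_ ?_ ?_).2)
  · exact Eventually.of_forall fun z => (measurable_exp_neg_mul_rpow z q).aestronglyMeasurable
  · exact integrableOn_exp_neg_mul_rpow hq hr
  · exact (by fun_prop : Measurable fun t : ℝ =>
      -(t : ℂ) * Complex.exp (-(r * t)) * ((t ^ q : ℝ) : ℂ)).aestronglyMeasurable
  · filter_upwards [ae_restrict_mem measurableSet_Ioi] with t ht z hz
    have ht : 0 < t := ht
    have hz : r.re / 2 < z.re := hz
    rw [norm_mul, norm_mul, norm_neg, norm_exp_neg_mul_ofReal, Complex.norm_real, Complex.norm_real,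
      Real.norm_of_nonneg ht.le, Real.norm_of_nonneg (Real.rpow_nonneg ht.le _),
      Real.rpow_add_one ht.ne']
    have : Real.exp (-(z.re * t)) ≤ Real.exp (-(r.re / 2 * t)) := by
      apply Real.exp_le_exp.2
      nlinarith
    calc t * Real.exp (-(z.re * t)) * t ^ q = t ^ q * t * Real.exp (-(z.re * t)) := by ring
      _ ≤ _ := mul_le_mul_of_nonneg_left this (by positivity)
  · exact integrableOn_rpow_mul_exp_neg (by linarith) (by linarith)
  · filter_upwards with t z _
    have h := (((hasDerivAt_id z).mul_const (t : ℂ)).neg.cexp).mul_const ((t ^ q : ℝ) : ℂ)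
    refine h.congr_deriv ?_
    simp only [Pi.neg_apply, id]
    ring

/-- Euler's integral for complex `r`, by the identity theorem from the case of real `r`. -/
theorem laplace_rpow {q : ℝ} (hq : -1 < q) {r : ℂ} (hr : 0 < r.re) :
    ∫ t in Ioi (0 : ℝ), Complex.exp (-(r * t)) * ((t ^ q : ℝ) : ℂ) =
      Real.Gamma (q + 1) * r ^ (-((q : ℂ) + 1)) := by
  have hopen : IsOpen {r : ℂ | 0 < r.re} := isOpen_lt continuous_const Complex.continuous_re
  have h1 := (differentiableOn_laplace_rpow hq).analyticOnNhd hopen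
  have h2 : AnalyticOnNhd ℂ (fun r : ℂ => (Real.Gamma (q + 1) : ℂ) * r ^ (-((q : ℂ) + 1)))
      {r : ℂ | 0 < r.re} := by
    refine DifferentiableOn.analyticOnNhd (fun z hz => ?_) hopen
    refine ((differentiableAt_id.cpow_const (Or.inl hz)).const_mul _).differentiableWithinAt
  refine h1.eqOn_of_preconnected_of_frequently_eq h2
    (convex_halfSpace_re_gt 0).isPreconnected (z₀ := 1) (by simp) ?_ hr
  -- On the positive reals, which accumulate at `1`, this is Euler's integral for `Γ`.
  have hreal : ∀ x : ℝ, 0 < x →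
      ∫ t in Ioi (0 : ℝ), Complex.exp (-((x : ℂ) * t)) * ((t ^ q : ℝ) : ℂ) =
      Real.Gamma (q + 1) * (x : ℂ) ^ (-((q : ℂ) + 1)) := by
    intro x hx
    have h := Real.integral_rpow_mul_exp_neg_mul_Ioi (a := q + 1) (by linarith) hx
    have h' := congrArg (fun y : ℝ => (y : ℂ)) h
    rw [← integral_complex_ofReal] at h'
    rw [show (-((q : ℂ) + 1)) = ((-(q + 1) : ℝ) : ℂ) by push_cast; ring,
      ← Complex.ofReal_cpow hx.le, Real.rpow_neg hx.le, ← Real.inv_rpow hx.le, ← one_div,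
      ← Complex.ofReal_mul, mul_comm (Real.Gamma _), ← h']
    refine integral_congr_ae (Eventually.of_forall fun t => ?_)
    simp [mul_comm]
  have hseq : Tendsto (fun x : ℝ => (x : ℂ)) (𝓝[>] 1) (𝓝[≠] 1) := by
    refine tendsto_nhdsWithin_iff.2 ⟨?_, ?_⟩
    · exact (Complex.continuous_ofReal.tendsto 1).mono_left nhdsWithin_le_nhds
    · filter_upwards [self_mem_nhdsWithin] with x hx
      have : (1 : ℝ) < x := hx
      simpa using this.ne'
  refine hseq.frequently (Eventually.frequently ?_)
  filter_upwards [self_mem_nhdsWithin] with x hx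
  exact hreal x (lt_trans one_pos hx)

/-! ### Repeated integration by parts -/

/-- `h 0, h 1, …, h m` are functions on `(0, ∞)`, each the derivative of the preceding one, and the
last one is continuous. -/
structure IsDerivChain (h : ℕ → ℝ → ℂ) (m : ℕ) : Prop where
  hasDerivAt : ∀ k < m, ∀ t : ℝ, 0 < t → HasDerivAt (h k) (h (k + 1) t) t
  continuousOn_last : ContinuousOn (h m) (Ioi 0)

namespace IsDerivChain

variable {h h' : ℕ → ℝ → ℂ} {m : ℕ}

theorem continuousOn (H : IsDerivChain h m) {k : ℕ} (hk : k ≤ m) : ContinuousOn (h k) (Ioi 0) := by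
  rcases hk.lt_or_eq with hk | rfl
  · exact fun t ht => (H.hasDerivAt k hk t ht).continuousAt.continuousWithinAt
  · exact H.continuousOn_last

theorem of_le (H : IsDerivChain h m) {k : ℕ} (hk : k ≤ m) : IsDerivChain h k :=
  ⟨fun j hj => H.hasDerivAt j (hj.trans_le hk), H.continuousOn hk⟩

theorem sub (H : IsDerivChain h m) (H' : IsDerivChain h' m) :
    IsDerivChain (fun k t => h k t - h' k t) m :=
  ⟨fun k hk t ht => (H.hasDerivAt k hk t ht).sub (H'.hasDerivAt k hk t ht),
    H.continuousOn_last.sub H'.continuousOn_last⟩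

theorem const_mul (H : IsDerivChain h m) (c : ℂ) : IsDerivChain (fun k t => c * h k t) m :=
  ⟨fun k hk t ht => (H.hasDerivAt k hk t ht).const_mul c,
    continuousOn_const.mul H.continuousOn_last⟩

theorem sum {ι : Type*} (s : Finset ι) {h : ι → ℕ → ℝ → ℂ} (H : ∀ i ∈ s, IsDerivChain (h i) m) :
    IsDerivChain (fun k t => ∑ i ∈ s, h i k t) m :=
  ⟨fun k hk t ht => HasDerivAt.fun_sum fun i hi => (H i hi).hasDerivAt k hk t ht,
    continuousOn_finsetSum _ fun i hi => (H i hi).continuousOn_last⟩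

end IsDerivChain

theorem isDerivChain_powDeriv (q : ℝ) (m : ℕ) : IsDerivChain (fun k t => (powDeriv q k t : ℂ)) m :=
  ⟨fun k _ _ ht => hasDerivAt_ofReal_powDeriv q k ht, continuousOn_ofReal_powDeriv q m⟩

theorem uIcc_subset_Ioi_zero {a b : ℝ} (ha : 0 < a) (hb : 0 < b) : uIcc a b ⊆ Ioi 0 :=
  fun _ hx => lt_of_lt_of_le (lt_min ha hb) hx.1

theorem intervalIntegrable_of_continuousOn_Ioi {F : ℝ → ℂ} (hF : ContinuousOn F (Ioi 0)) {a b : ℝ}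
    (ha : 0 < a) (hb : 0 < b) : IntervalIntegrable F volume a b :=
  (hF.mono (uIcc_subset_Ioi_zero ha hb)).intervalIntegrable

theorem continuous_exp_neg_mul (r : ℂ) : Continuous fun t : ℝ => Complex.exp (-(r * t)) := by
  fun_prop

theorem integral_exp_mul_eq_of_hasDerivAt {h h' : ℝ → ℂ} {r : ℂ} (hr : r ≠ 0) {a b : ℝ}
    (ha : 0 < a) (hb : 0 < b) (hd : ∀ t : ℝ, 0 < t → HasDerivAt h (h' t) t)
    (hc : ContinuousOn h' (Ioi 0)) :
    ∫ t in a..b, Complex.exp (-(r * t)) * h t =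
      (Complex.exp (-(r * a)) * h a - Complex.exp (-(r * b)) * h b) / r +
        (∫ t in a..b, Complex.exp (-(r * t)) * h' t) / r := by
  have hv : ∀ t : ℝ, HasDerivAt (fun t : ℝ => -Complex.exp (-(r * t)) / r)
      (Complex.exp (-(r * t))) t := by
    intro t
    have h1 := ((((Complex.ofRealCLM.hasDerivAt (x := t)).const_mul r).neg.cexp).neg.div_const r)
    refine h1.congr_deriv ?_
    simp
    field_simp
  have hsub := uIcc_subset_Ioi_zero ha hb
  have key := intervalIntegral.integral_mul_deriv_eq_deriv_mul (a := a) (b := b)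
    (u := h) (u' := h') (v := fun t : ℝ => -Complex.exp (-(r * t)) / r)
    (v' := fun t : ℝ => Complex.exp (-(r * t))) (fun t ht => hd t (hsub ht)) (fun t _ => hv t)
    (intervalIntegrable_of_continuousOn_Ioi hc ha hb)
    ((continuous_exp_neg_mul r).intervalIntegrable _ _)
  have e1 : ∀ t : ℝ, Complex.exp (-(r * t)) * h t = h t * Complex.exp (-(r * t)) :=
    fun t => mul_comm _ _
  have e2 : ∀ t : ℝ, h' t * (-Complex.exp (-(r * t)) / r) =
      (-1 / r) * (Complex.exp (-(r * t)) * h' t) := fun t => by ring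
  simp only [e2, intervalIntegral.integral_const_mul] at key
  rw [intervalIntegral.integral_congr fun t _ => e1 t, key]
  ring

/-- Repeated integration by parts on a compact subinterval of `(0, ∞)`. -/
theorem IsDerivChain.integral_exp_mul {h : ℕ → ℝ → ℂ} {m : ℕ} (H : IsDerivChain h m) {r : ℂ}
    (hr : r ≠ 0) {a b : ℝ} (ha : 0 < a) (hb : 0 < b) :
    ∫ t in a..b, Complex.exp (-(r * t)) * h 0 t =
      ∑ k ∈ Finset.range m,
        (Complex.exp (-(r * a)) * h k a - Complex.exp (-(r * b)) * h k b) / r ^ (k + 1) +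
        (∫ t in a..b, Complex.exp (-(r * t)) * h m t) / r ^ m := by
  induction m with
  | zero => simp
  | succ m ih =>
    rw [ih (H.of_le m.le_succ), Finset.sum_range_succ,
      integral_exp_mul_eq_of_hasDerivAt hr ha hb (H.hasDerivAt m m.lt_succ_self)
        H.continuousOn_last]
    field_simp
    ring

theorem tendsto_integral_left_endpoint {F : ℝ → ℂ} (hF : IntervalIntegrable F volume 0 1) :
    Tendsto (fun ε : ℝ => ∫ t in ε..1, F t) (𝓝[>] 0) (𝓝 (∫ t in (0 : ℝ)..1, F t)) := by
  have h := intervalIntegral.continuousOn_primitive_interval_left (μ := volume) (f := F)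
    (a := 0) (b := 1) ((intervalIntegrable_iff' (by simp)).1 hF)
  have h0 := h 0 left_mem_uIcc
  refine h0.mono_left ?_
  rw [uIcc_of_le zero_le_one]
  exact nhdsWithin_le_of_mem (Icc_mem_nhdsGT_of_mem (by simp))

theorem intervalIntegrable_exp_mul {F : ℝ → ℂ} {a b : ℝ} (hF : IntervalIntegrable F volume a b)
    (r : ℂ) : IntervalIntegrable (fun t : ℝ => Complex.exp (-(r * t)) * F t) volume a b :=
  hF.continuousOn_mul (continuous_exp_neg_mul r).continuousOn

/-- Repeated integration by parts on `(0, 1]` when the boundary terms at the origin vanish. -/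
theorem IsDerivChain.integral_exp_mul_zero_one {h : ℕ → ℝ → ℂ} {m : ℕ} (H : IsDerivChain h m)
    {r : ℂ} (hr : r ≠ 0) (h0 : ∀ k < m, Tendsto (h k) (𝓝[>] 0) (𝓝 0))
    (hi0 : IntervalIntegrable (h 0) volume 0 1) (him : IntervalIntegrable (h m) volume 0 1) :
    ∫ t in (0 : ℝ)..1, Complex.exp (-(r * t)) * h 0 t =
      -∑ k ∈ Finset.range m, Complex.exp (-r) * h k 1 / r ^ (k + 1) +
        (∫ t in (0 : ℝ)..1, Complex.exp (-(r * t)) * h m t) / r ^ m := by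
  have hL := tendsto_integral_left_endpoint (intervalIntegrable_exp_mul hi0 r)
  refine tendsto_nhds_unique hL ?_
  have hR := tendsto_integral_left_endpoint (intervalIntegrable_exp_mul him r)
  have hE : Tendsto (fun ε : ℝ => Complex.exp (-(r * ε))) (𝓝[>] 0) (𝓝 1) := by
    have := (continuous_exp_neg_mul r).tendsto 0
    simp only [Complex.ofReal_zero, mul_zero, neg_zero, Complex.exp_zero] at this
    exact this.mono_left nhdsWithin_le_nhds
  have hS : Tendsto (fun ε : ℝ => ∑ k ∈ Finset.range m,
      (Complex.exp (-(r * ε)) * h k ε - Complex.exp (-(r * (1 : ℝ))) * h k 1) / r ^ (k + 1))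
      (𝓝[>] 0) (𝓝 (∑ k ∈ Finset.range m,
        (1 * 0 - Complex.exp (-(r * (1 : ℝ))) * h k 1) / r ^ (k + 1))) :=
    tendsto_finsetSum _ fun k hk =>
      ((hE.mul (h0 k (Finset.mem_range.1 hk))).sub_const _).div_const _
  have hT := hS.add (hR.div_const (r ^ m))
  have he : (∑ k ∈ Finset.range m, (1 * 0 - Complex.exp (-(r * (1 : ℝ))) * h k 1) / r ^ (k + 1)) =
      -∑ k ∈ Finset.range m, Complex.exp (-r) * h k 1 / r ^ (k + 1) := by
    rw [← Finset.sum_neg_distrib]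
    refine Finset.sum_congr rfl fun k _ => ?_
    simp
    ring
  rw [he] at hT
  refine hT.congr' ?_
  filter_upwards [self_mem_nhdsWithin] with ε hε
  exact (H.integral_exp_mul hr hε one_pos).symm

/-- Repeated integration by parts on `[1, ∞)` when the boundary terms at infinity vanish. -/
theorem IsDerivChain.tendsto_integral_exp_mul {h : ℕ → ℝ → ℂ} {m : ℕ} (H : IsDerivChain h m)
    {r : ℂ} (hr : r ≠ 0) (h0 : ∀ k < m, Tendsto (fun R : ℝ => Complex.exp (-(r * R)) * h k R)
      atTop (𝓝 0)) {J : ℂ}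
    (hJ : Tendsto (fun R : ℝ => ∫ t in (1 : ℝ)..R, Complex.exp (-(r * t)) * h m t) atTop (𝓝 J)) :
    Tendsto (fun R : ℝ => ∫ t in (1 : ℝ)..R, Complex.exp (-(r * t)) * h 0 t) atTop
      (𝓝 (∑ k ∈ Finset.range m, Complex.exp (-r) * h k 1 / r ^ (k + 1) + J / r ^ m)) := by
  have hS : Tendsto (fun R : ℝ => ∑ k ∈ Finset.range m,
      (Complex.exp (-(r * (1 : ℝ))) * h k 1 - Complex.exp (-(r * R)) * h k R) / r ^ (k + 1))
      atTop (𝓝 (∑ k ∈ Finset.range m,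
        (Complex.exp (-(r * (1 : ℝ))) * h k 1 - 0) / r ^ (k + 1))) :=
    tendsto_finsetSum _ fun k hk => ((h0 k (Finset.mem_range.1 hk)).const_sub _).div_const _
  have hT := hS.add (hJ.div_const (r ^ m))
  simp only [sub_zero, Complex.ofReal_one, mul_one] at hT
  refine hT.congr' ?_
  filter_upwards [eventually_gt_atTop 0] with R hR
  have := H.integral_exp_mul hr one_pos hR
  simp only [Complex.ofReal_one, mul_one] at this
  exact this.symm

/-! ### Boundary terms at infinity and the Riemann-Lebesgue lemma -/

/-- A modulation `e^{iωR} g(R)` can converge for two different frequencies only if `g` tends to `0`: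
sampling at the points where the two phases agree, and where they are opposite, the limits must be
both equal and opposite. -/
theorem tendsto_zero_of_tendsto_two_frequencies {g : ℝ → ℂ} {ω ω' : ℝ} (hlt : ω < ω') {L L' : ℂ}
    (h : Tendsto (fun R : ℝ => Complex.exp (Complex.I * ω * R) * g R) atTop (𝓝 L))
    (h' : Tendsto (fun R : ℝ => Complex.exp (Complex.I * ω' * R) * g R) atTop (𝓝 L')) :
    Tendsto g atTop (𝓝 0) := by
  have hδ : 0 < ω' - ω := sub_pos.2 hlt
  have hδ' : ((ω' : ℂ) - ω) ≠ 0 := by exact_mod_cast hδ.ne'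
  have hmod : ∀ R : ℝ, Complex.exp (Complex.I * ω' * R) * g R =
      Complex.exp (Complex.I * (ω' - ω) * R) * (Complex.exp (Complex.I * ω * R) * g R) := by
    intro R
    rw [← mul_assoc, ← Complex.exp_add]
    congr 2
    ring
  have hseq : ∀ c : ℝ, Tendsto (fun n : ℕ => ((2 * n + c) * Real.pi) / (ω' - ω)) atTop atTop := by
    intro c
    refine Tendsto.atTop_div_const hδ (Tendsto.atTop_mul_const Real.pi_pos ?_)
    exact tendsto_atTop_add_const_right _ _
      (tendsto_natCast_atTop_atTop.const_mul_atTop two_pos)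
  have hph : ∀ (c : ℝ) (n : ℕ), Complex.exp (Complex.I * (ω' - ω) *
      ((((2 * n + c) * Real.pi) / (ω' - ω) : ℝ) : ℂ)) = Complex.exp (c * Real.pi * Complex.I) := by
    intro c n
    rw [← Complex.exp_periodic.nat_mul n (c * Real.pi * Complex.I)]
    congr 1
    push_cast
    field_simp
    ring
  have e1 : L = L' := by
    refine tendsto_nhds_unique (h.comp (hseq 0)) ((h'.comp (hseq 0)).congr fun n => ?_)
    simp only [Function.comp_apply]
    rw [hmod, hph]
    simp
  have e2 : L' = -L := by
    refine tendsto_nhds_unique (h'.comp (hseq 1)) ((h.comp (hseq 1)).neg.congr fun n => ?_)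
    simp only [Function.comp_apply]
    rw [hmod, hph]
    simp
  have e3 : L = 0 := self_eq_neg.1 (e1.trans e2)
  rw [e3] at h
  rw [tendsto_zero_iff_norm_tendsto_zero] at h ⊢
  refine h.congr fun R => ?_
  have := Complex.norm_exp_ofReal_mul_I (ω * R)
  rw [norm_mul, show Complex.I * ω * R = ((ω * R : ℝ) : ℂ) * Complex.I by push_cast; ring, this,
    one_mul]

/-- The Riemann-Lebesgue lemma for the kernel `e^{iωt}` on a measurable set. -/
theorem tendsto_setIntegral_exp_mul_atTop (h : ℝ → ℂ) {S : Set ℝ} (hS : MeasurableSet S) :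
    Tendsto (fun ω : ℝ => ∫ t in S, Complex.exp (Complex.I * ω * t) * h t) atTop (𝓝 0) := by
  have h1 := Real.tendsto_integral_exp_smul_cocompact (S.indicator h)
  have h2 : Tendsto (fun ω : ℝ => -ω / (2 * Real.pi)) atTop (cocompact ℝ) :=
    (Tendsto.atBot_div_const (by positivity) tendsto_neg_atTop_atBot).mono_right
      atBot_le_cocompact
  refine (h1.comp h2).congr fun ω => ?_
  simp only [Function.comp_apply]
  rw [← integral_indicator hS]
  refine integral_congr_ae (Eventually.of_forall fun t => ?_)
  by_cases ht : t ∈ S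
  · simp only [indicator_of_mem ht]
    rw [Circle.smul_def, smul_eq_mul, Real.fourierChar_apply]
    congr 2
    have : (Real.pi : ℂ) ≠ 0 := by exact_mod_cast Real.pi_ne_zero
    push_cast
    field_simp
  · simp [indicator_of_notMem ht]

theorem exp_neg_neg_I_mul (ω t : ℝ) :
    Complex.exp (-(-(Complex.I * ω) * t)) = Complex.exp (Complex.I * ω * t) := by
  congr 1
  ring

/-- If the Fourier integrals over `[1, ∞)` of all functions of a chain of derivatives converge for
large frequencies, then all but the last function tend to `0` at infinity. -/
theorem IsDerivChain.tendsto_zero_of_tails {g : ℕ → ℝ → ℂ} {m : ℕ} (H : IsDerivChain g m) {Ω : ℝ}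
    {J : ℕ → ℝ → ℂ} (hJ : ∀ s ≤ m, ∀ ω : ℝ, Ω ≤ ω → Tendsto (fun R : ℝ =>
      ∫ t in (1 : ℝ)..R, Complex.exp (Complex.I * ω * t) * g s t) atTop (𝓝 (J s ω)))
    {k : ℕ} (hk : k < m) : Tendsto (g k) atTop (𝓝 0) := by
  have hconv : ∀ ω : ℝ, max Ω 1 ≤ ω → ∃ L, Tendsto (fun R : ℝ =>
      Complex.exp (Complex.I * ω * R) * g k R) atTop (𝓝 L) := by
    intro ω hω
    have hω0 : (ω : ℂ) ≠ 0 := by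
      have : (0 : ℝ) < ω := lt_of_lt_of_le one_pos ((le_max_right _ _).trans hω)
      exact_mod_cast this.ne'
    have hr : -(Complex.I * (ω : ℂ)) ≠ 0 := neg_ne_zero.2 (mul_ne_zero Complex.I_ne_zero hω0)
    have h0 := hJ k hk.le ω ((le_max_left _ _).trans hω)
    have h1 := hJ (k + 1) hk ω ((le_max_left _ _).trans hω)
    refine ⟨_, (((h0.const_mul (-(Complex.I * (ω : ℂ)))).const_sub
      (Complex.exp (-(-(Complex.I * ω) * (1 : ℝ))) * g k 1)).add h1).congr' ?_⟩
    filter_upwards [eventually_gt_atTop 0] with R hR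
    have := integral_exp_mul_eq_of_hasDerivAt hr one_pos hR (H.hasDerivAt k hk) (H.continuousOn hk)
    simp only [exp_neg_neg_I_mul] at this ⊢
    rw [this]
    field_simp
    ring
  obtain ⟨L, hL⟩ := hconv (max Ω 1) le_rfl
  obtain ⟨L', hL'⟩ := hconv (max Ω 1 + 1) (by linarith)
  exact tendsto_zero_of_tendsto_two_frequencies (by linarith) hL hL'

/-! ### Fourier integrals of powers over the unit interval -/

theorem integrableOn_exp_mul {F : ℝ → ℂ} {S : Set ℝ} (hS : MeasurableSet S) (hS0 : S ⊆ Ici 0)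
    (hF : IntegrableOn F S) {r : ℂ} (hr : 0 ≤ r.re) :
    IntegrableOn (fun t : ℝ => Complex.exp (-(r * t)) * F t) S := by
  refine Integrable.bdd_mul (c := 1) hF (continuous_exp_neg_mul r).aestronglyMeasurable ?_
  filter_upwards [ae_restrict_mem hS] with t ht
  exact norm_exp_neg_mul_ofReal_le_one hr (hS0 ht)

/-- Laplace integrals of integrable functions extend continuously to the imaginary axis. -/
theorem tendsto_setIntegral_exp_mul_of_pos {F : ℝ → ℂ} {S : Set ℝ} (hS : MeasurableSet S)
    (hS0 : S ⊆ Ici 0) (hF : IntegrableOn F S) {r : ℂ} (hr : 0 ≤ r.re) :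
    Tendsto (fun δ : ℝ => ∫ t in S, Complex.exp (-((r + δ) * t)) * F t) (𝓝[>] 0)
      (𝓝 (∫ t in S, Complex.exp (-(r * t)) * F t)) := by
  refine tendsto_integral_filter_of_dominated_convergence (fun t => ‖F t‖) ?_ ?_ hF.norm ?_
  · filter_upwards [self_mem_nhdsWithin] with δ hδ
    exact (continuous_exp_neg_mul _).aestronglyMeasurable.mul hF.aestronglyMeasurable
  · filter_upwards [self_mem_nhdsWithin] with δ hδ
    have hδ : 0 < δ := hδ
    filter_upwards [ae_restrict_mem hS] with t ht
    rw [norm_mul]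
    refine mul_le_of_le_one_left (norm_nonneg _) (norm_exp_neg_mul_ofReal_le_one ?_ (hS0 ht))
    simp only [Complex.add_re, Complex.ofReal_re]
    linarith
  · refine Eventually.of_forall fun t => ?_
    have : Continuous fun δ : ℝ => Complex.exp (-((r + δ) * t)) * F t := by fun_prop
    have h := this.tendsto 0
    simp only [Complex.ofReal_zero, add_zero] at h
    exact h.mono_left nhdsWithin_le_nhds

theorem tendsto_exp_mul_powDeriv {r : ℂ} (hr : 0 < r.re) (q : ℝ) (k : ℕ) :
    Tendsto (fun R : ℝ => Complex.exp (-(r * R)) * (powDeriv q k R : ℂ)) atTop (𝓝 0) := by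
  rw [tendsto_zero_iff_norm_tendsto_zero]
  have h := (tendsto_rpow_mul_exp_neg_mul_atTop_nhds_zero (q - k) r.re hr).const_mul
    |∏ i ∈ Finset.range k, (q - i)|
  rw [mul_zero] at h
  refine h.congr' ?_
  filter_upwards [eventually_gt_atTop 0] with R hR
  rw [norm_mul, norm_exp_neg_mul_ofReal, Complex.norm_real, powDeriv, norm_mul, Real.norm_eq_abs,
    Real.norm_of_nonneg (Real.rpow_nonneg hR.le _), neg_mul]
  ring

theorem intervalIntegrable_ofReal_rpow {q : ℝ} (hq : -1 < q) :
    IntervalIntegrable (fun t : ℝ => ((t ^ q : ℝ) : ℂ)) volume 0 1 :=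
  have h := intervalIntegral.intervalIntegrable_rpow' (a := 0) (b := 1) hq
  ⟨Integrable.ofReal h.1, Integrable.ofReal h.2⟩

/-- Euler's integral restricted to `(0, 1]`: the missing part over `(1, ∞)` is expressed by
`m`-fold integration by parts, so that the right-hand side makes sense up to the imaginary axis. -/
theorem integral_zero_one_exp_mul_rpow {q : ℝ} (hq : -1 < q) {m : ℕ}
    (hint : IntegrableOn (fun t : ℝ => (powDeriv q m t : ℂ)) (Ioi 1)) {r : ℂ} (hr : 0 ≤ r.re)
    (hr0 : r ≠ 0) :
    ∫ t in (0 : ℝ)..1, Complex.exp (-(r * t)) * ((t ^ q : ℝ) : ℂ) =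
      Real.Gamma (q + 1) * r ^ (-((q : ℂ) + 1)) -
        (∑ k ∈ Finset.range m, Complex.exp (-r) * powDeriv q k 1 / r ^ (k + 1) +
          (∫ t in Ioi (1 : ℝ), Complex.exp (-(r * t)) * (powDeriv q m t : ℂ)) / r ^ m) := by
  have hsub : Ioi (1 : ℝ) ⊆ Ici 0 := fun t ht =>
    (zero_le_one.trans (le_of_lt (mem_Ioi.1 ht)) : (0 : ℝ) ≤ t)
  have hsub' : Ioc (0 : ℝ) 1 ⊆ Ici 0 := fun t ht => ht.1.le
  have hpos : ∀ r : ℂ, 0 < r.re →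
      ∫ t in (0 : ℝ)..1, Complex.exp (-(r * t)) * ((t ^ q : ℝ) : ℂ) =
      Real.Gamma (q + 1) * r ^ (-((q : ℂ) + 1)) -
        (∑ k ∈ Finset.range m, Complex.exp (-r) * powDeriv q k 1 / r ^ (k + 1) +
          (∫ t in Ioi (1 : ℝ), Complex.exp (-(r * t)) * (powDeriv q m t : ℂ)) / r ^ m) := by
    intro r hr
    have hr0 : r ≠ 0 := by
      rintro rfl
      simp at hr
    have hI := integrableOn_exp_neg_mul_rpow hq hr
    have h1 := intervalIntegral_tendsto_integral_Ioi 1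
      (integrableOn_exp_mul measurableSet_Ioi hsub hint hr.le) tendsto_id
    have h2 := (isDerivChain_powDeriv q m).tendsto_integral_exp_mul hr0
      (fun k _ => tendsto_exp_mul_powDeriv hr q k) h1
    have h3 := intervalIntegral_tendsto_integral_Ioi 1
      (hI.mono_set (Ioi_subset_Ioi zero_le_one)) tendsto_id
    simp only [powDeriv_zero, id] at h2 h3
    rw [← tendsto_nhds_unique h3 h2, ← laplace_rpow hq hr,
      intervalIntegral.integral_of_le zero_le_one, ← Ioc_union_Ioi_eq_Ioi (zero_le_one (α := ℝ)),
      setIntegral_union Ioc_disjoint_Ioi_same measurableSet_Ioi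
        (hI.mono_set Ioc_subset_Ioi_self) (hI.mono_set (Ioi_subset_Ioi zero_le_one))]
    ring
  have hadd : Tendsto (fun δ : ℝ => r + δ) (𝓝[>] 0) (𝓝 r) := by
    have : Continuous fun δ : ℝ => r + δ := by fun_prop
    have h := this.tendsto 0
    simp only [Complex.ofReal_zero, add_zero] at h
    exact h.mono_left nhdsWithin_le_nhds
  have hslit : r ∈ Complex.slitPlane := by
    rcases hr.lt_or_eq with h | h
    · exact Or.inl h
    · exact Or.inr fun h' => hr0 (Complex.ext h.symm h')
  have hq' : IntegrableOn (fun t : ℝ => ((t ^ q : ℝ) : ℂ)) (Ioc 0 1) := by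
    exact (intervalIntegrable_iff_integrableOn_Ioc_of_le zero_le_one).1
      (intervalIntegrable_ofReal_rpow hq)
  have hL := tendsto_setIntegral_exp_mul_of_pos measurableSet_Ioc hsub' hq' hr
  have hR := tendsto_setIntegral_exp_mul_of_pos measurableSet_Ioi hsub hint hr
  have hG := ((hadd.cpow tendsto_const_nhds hslit :
    Tendsto (fun δ : ℝ => (r + δ) ^ (-((q : ℂ) + 1))) (𝓝[>] 0) _)).const_mul
      (Real.Gamma (q + 1) : ℂ)
  have hS : Tendsto (fun δ : ℝ => ∑ k ∈ Finset.range m,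
      Complex.exp (-(r + δ)) * powDeriv q k 1 / (r + δ) ^ (k + 1)) (𝓝[>] 0)
      (𝓝 (∑ k ∈ Finset.range m, Complex.exp (-r) * powDeriv q k 1 / r ^ (k + 1))) :=
    tendsto_finsetSum _ fun k _ => ((hadd.neg.cexp).mul_const _).div (hadd.pow _)
      (pow_ne_zero _ hr0)
  have hT := hG.sub (hS.add (hR.div (hadd.pow m) (pow_ne_zero _ hr0)))
  rw [intervalIntegral.integral_of_le zero_le_one]
  refine tendsto_nhds_unique hL (hT.congr' ?_)
  filter_upwards [self_mem_nhdsWithin] with δ hδ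
  have hδ : 0 < δ := hδ
  rw [← intervalIntegral.integral_of_le zero_le_one]
  refine (hpos (r + δ) ?_).symm
  simp only [Complex.add_re, Complex.ofReal_re]
  linarith

/-! ### The regularized Fourier integral of a singular power -/

/-- The conditionally convergent integral `∫_1^∞ e^{-rt} t^q dt` (`q < 0`, `Re r ≥ 0`, `r ≠ 0`),
in the absolutely convergent form that one integration by parts gives. -/
noncomputable def powTail (q : ℝ) (r : ℂ) : ℂ :=
  Complex.exp (-r) / r + (∫ t in Ioi (1 : ℝ), Complex.exp (-(r * t)) * (powDeriv q 1 t : ℂ)) / r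

theorem powDeriv_one (q t : ℝ) : powDeriv q 1 t = q * t ^ (q - 1) := by
  simp [powDeriv]

theorem integrableOn_powDeriv {q : ℝ} {m : ℕ} (h : q - m < -1) :
    IntegrableOn (fun t : ℝ => (powDeriv q m t : ℂ)) (Ioi 1) :=
  ((integrableOn_Ioi_rpow_of_lt h one_pos).const_mul _).ofReal

theorem Ioi_one_subset_Ici_zero : Ioi (1 : ℝ) ⊆ Ici 0 := fun t ht =>
  (zero_le_one.trans (le_of_lt (mem_Ioi.1 ht)) : (0 : ℝ) ≤ t)

theorem tendsto_integral_exp_mul_rpow {q : ℝ} (hq : q < 0) {r : ℂ} (hr : 0 ≤ r.re) (hr0 : r ≠ 0) :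
    Tendsto (fun R : ℝ => ∫ t in (1 : ℝ)..R, Complex.exp (-(r * t)) * ((t ^ q : ℝ) : ℂ)) atTop
      (𝓝 (powTail q r)) := by
  have hint : IntegrableOn (fun t : ℝ => (powDeriv q 1 t : ℂ)) (Ioi 1) :=
    integrableOn_powDeriv (by push_cast; linarith)
  have h1 := intervalIntegral_tendsto_integral_Ioi 1
    (integrableOn_exp_mul measurableSet_Ioi Ioi_one_subset_Ici_zero hint hr) tendsto_id
  have h2 := (isDerivChain_powDeriv q 1).tendsto_integral_exp_mul hr0 (fun k hk => ?_) h1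
  · simpa [powDeriv_zero, powTail] using h2
  · obtain rfl : k = 0 := by omega
    simp only [powDeriv_zero]
    have h := tendsto_rpow_neg_atTop (neg_pos.2 hq)
    rw [neg_neg] at h
    refine squeeze_zero_norm' ?_ h
    filter_upwards [eventually_gt_atTop 0] with R hR
    rw [norm_mul, Complex.norm_real, Real.norm_of_nonneg (Real.rpow_nonneg hR.le _)]
    exact mul_le_of_le_one_left (Real.rpow_nonneg hR.le _)
      (norm_exp_neg_mul_ofReal_le_one hr hR.le)

/-- Integration by parts relates the tails with exponents `q` and `q - 1`. -/
theorem powTail_eq {q : ℝ} (hq : q < 0) {r : ℂ} (hr : 0 ≤ r.re) (hr0 : r ≠ 0) :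
    powTail q r = Complex.exp (-r) / r + q * powTail (q - 1) r / r := by
  have hint : IntegrableOn (fun t : ℝ => (powDeriv q 1 t : ℂ)) (Ioi 1) :=
    integrableOn_powDeriv (by push_cast; linarith)
  have h1 := intervalIntegral_tendsto_integral_Ioi 1
    (integrableOn_exp_mul measurableSet_Ioi Ioi_one_subset_Ici_zero hint hr) tendsto_id
  have h2 := (tendsto_integral_exp_mul_rpow (q := q - 1) (by linarith) hr hr0).const_mul (q : ℂ)
  rw [powTail, tendsto_nhds_unique h1 (h2.congr fun R => ?_)]
  rw [← intervalIntegral.integral_const_mul, id]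
  refine intervalIntegral.integral_congr fun t _ => ?_
  simp only [powDeriv_one]
  push_cast
  ring

theorem integral_zero_one_exp_mul_rpow_of_neg {q : ℝ} (hq : -1 < q) (hq0 : q < 0) {r : ℂ}
    (hr : 0 ≤ r.re) (hr0 : r ≠ 0) :
    ∫ t in (0 : ℝ)..1, Complex.exp (-(r * t)) * ((t ^ q : ℝ) : ℂ) =
      Real.Gamma (q + 1) * r ^ (-((q : ℂ) + 1)) - powTail q r := by
  rw [integral_zero_one_exp_mul_rpow hq (m := 1)
    (integrableOn_powDeriv (by push_cast; linarith)) hr hr0]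
  simp [powTail, powDeriv_zero]

theorem norm_exp_I_sub_one_mul_rpow_le {ω t : ℝ} (ht : 0 < t) (q : ℝ) :
    ‖(Complex.exp (Complex.I * ω * t) - 1) * ((t ^ q : ℝ) : ℂ)‖ ≤ |ω| * t ^ (q + 1) := by
  rw [norm_mul, Complex.norm_real, Real.norm_of_nonneg (Real.rpow_nonneg ht.le _),
    Real.rpow_add_one ht.ne']
  have h := Real.norm_exp_I_mul_ofReal_sub_one_le (x := ω * t)
  rw [Real.norm_eq_abs, abs_mul, abs_of_pos ht, Complex.ofReal_mul, ← mul_assoc] at h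
  calc _ ≤ |ω| * t * t ^ q := mul_le_mul_of_nonneg_right h (Real.rpow_nonneg ht.le _)
    _ = _ := by ring

theorem intervalIntegrable_exp_I_sub_one_mul_rpow (ω : ℝ) {q : ℝ} (hq : -2 < q) :
    IntervalIntegrable (fun t : ℝ => (Complex.exp (Complex.I * ω * t) - 1) * ((t ^ q : ℝ) : ℂ))
      volume 0 1 := by
  rw [intervalIntegrable_iff_integrableOn_Ioc_of_le zero_le_one]
  have h := (intervalIntegral.intervalIntegrable_rpow' (a := 0) (b := 1) (r := q + 1)
    (by linarith)).const_mul |ω|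
  rw [intervalIntegrable_iff_integrableOn_Ioc_of_le zero_le_one] at h
  refine Integrable.mono' h (Measurable.aestronglyMeasurable (by fun_prop)) ?_
  filter_upwards [ae_restrict_mem measurableSet_Ioc] with t ht
  exact norm_exp_I_sub_one_mul_rpow_le ht.1 q

theorem integral_exp_I_sub_one_mul_rpow {α ω : ℝ} (hα0 : 0 < α) (hα1 : α < 1) :
    ∫ t in (0 : ℝ)..1, (Complex.exp (Complex.I * ω * t) - 1) * ((t ^ (-α - 1) : ℝ) : ℂ) =
      -(Complex.exp (Complex.I * ω) - 1) / α + Complex.I * ω / α *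
        ∫ t in (0 : ℝ)..1, Complex.exp (Complex.I * ω * t) * ((t ^ (-α) : ℝ) : ℂ) := by
  have hα : (α : ℂ) ≠ 0 := by exact_mod_cast hα0.ne'
  have hi1 := intervalIntegrable_exp_I_sub_one_mul_rpow ω (q := -α - 1) (by linarith)
  have hi2 : IntervalIntegrable (fun t : ℝ => Complex.exp (Complex.I * ω * t) *
      ((t ^ (-α) : ℝ) : ℂ)) volume 0 1 := by
    have := intervalIntegrable_exp_mul (intervalIntegrable_ofReal_rpow (q := -α) (by linarith))
      (-(Complex.I * ω))
    simpa only [exp_neg_neg_I_mul] using this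
  have key := intervalIntegral.integral_eq_sub_of_hasDerivAt_of_tendsto (a := 0) (b := 1)
    (f := fun t : ℝ => (Complex.exp (Complex.I * ω * t) - 1) * ((t ^ (-α) : ℝ) : ℂ))
    (f' := fun t : ℝ => Complex.I * ω * (Complex.exp (Complex.I * ω * t) * ((t ^ (-α) : ℝ) : ℂ)) +
      -α * ((Complex.exp (Complex.I * ω * t) - 1) * ((t ^ (-α - 1) : ℝ) : ℂ)))
    (fa := 0) (fb := Complex.exp (Complex.I * ω) - 1) one_pos ?_
    ((hi2.const_mul _).add (hi1.const_mul _)) ?_ ?_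
  · rw [intervalIntegral.integral_add (hi2.const_mul _) (hi1.const_mul _),
      intervalIntegral.integral_const_mul, intervalIntegral.integral_const_mul] at key
    field_simp
    linear_combination -key
  · intro t ht
    have h1 := (((Complex.ofRealCLM.hasDerivAt (x := t)).const_mul
      (Complex.I * ω)).cexp.sub_const 1).mul (hasDerivAt_ofReal_powDeriv (-α) 0 ht.1)
    simp only [zero_add, powDeriv_one, powDeriv_zero] at h1
    refine h1.congr_deriv ?_
    simp
    ring
  · have h : Tendsto (fun t : ℝ => |ω| * t ^ (-α + 1)) (𝓝[>] 0) (𝓝 0) := by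
      have := ((Real.continuousAt_rpow_const 0 (-α + 1) (Or.inr (by linarith))).tendsto).const_mul
        |ω|
      rw [Real.zero_rpow (by linarith), mul_zero] at this
      exact this.mono_left nhdsWithin_le_nhds
    refine squeeze_zero_norm' ?_ h
    filter_upwards [self_mem_nhdsWithin] with t ht
    exact norm_exp_I_sub_one_mul_rpow_le ht _
  · have : ContinuousAt (fun t : ℝ => (Complex.exp (Complex.I * ω * t) - 1) *
        ((t ^ (-α) : ℝ) : ℂ)) 1 := by
      refine ContinuousAt.mul (by fun_prop) ?_
      exact Complex.continuous_ofReal.continuousAt.comp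
        (Real.continuousAt_rpow_const 1 (-α) (Or.inl one_ne_zero))
    have h := this.tendsto
    simp only [Complex.ofReal_one, mul_one, Real.one_rpow] at h
    exact h.mono_left nhdsWithin_le_nhds

/-- The integral of `(e^{iωt} - 𝟙_{t ≤ 1}) t ^ (-α - 1)` over `(0, ∞)`, which for `0 ≤ α < 1` is the
finite part of `∫_0^∞ e^{iωt} t ^ (-α - 1) dt` up to the finite part of `∫_0^1 t ^ (-α - 1) dt`. -/
noncomputable def regularizedPowIntegral (α ω : ℝ) : ℂ :=
  (∫ t in (0 : ℝ)..1, (Complex.exp (Complex.I * ω * t) - 1) * ((t ^ (-α - 1) : ℝ) : ℂ)) +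
    powTail (-α - 1) (-(Complex.I * ω))

theorem neg_I_mul_ne_zero {ω : ℝ} (hω : 0 < ω) : -(Complex.I * (ω : ℂ)) ≠ 0 :=
  neg_ne_zero.2 (mul_ne_zero Complex.I_ne_zero (by exact_mod_cast hω.ne'))

theorem neg_I_mul_re (ω : ℝ) : (-(Complex.I * (ω : ℂ))).re = 0 := by simp

theorem log_neg_I_mul {ω : ℝ} (hω : 0 < ω) :
    Complex.log (-(Complex.I * (ω : ℂ))) = Real.log ω - Real.pi / 2 * Complex.I := by
  rw [show -(Complex.I * (ω : ℂ)) = (ω : ℂ) * -Complex.I by ring,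
    Complex.log_ofReal_mul hω (neg_ne_zero.2 Complex.I_ne_zero), Complex.log_neg_I]
  ring

theorem neg_I_mul_cpow {ω : ℝ} (hω : 0 < ω) (s : ℝ) :
    (-(Complex.I * (ω : ℂ))) ^ (s : ℂ) =
      ((ω ^ s : ℝ) : ℂ) * Complex.exp (-(Real.pi / 2 * s * Complex.I)) := by
  rw [Complex.cpow_def_of_ne_zero (neg_I_mul_ne_zero hω), log_neg_I_mul hω, Real.rpow_def_of_pos hω,
    Complex.ofReal_exp, ← Complex.exp_add]
  congr 1
  push_cast
  ring

/-- Integrating `t ^ (-α - 1)` on both sides of `1` reduces the claim to Euler's integral with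
exponent `-α`; the tails and the boundary terms at `1` cancel. -/
theorem regularizedPowIntegral_of_pos {α ω : ℝ} (hα0 : 0 < α) (hα1 : α < 1) (hω : 0 < ω) :
    regularizedPowIntegral α ω =
      (1 - Real.Gamma (1 - α) * (-(Complex.I * (ω : ℂ))) ^ (α : ℂ)) / α := by
  have hα : (α : ℂ) ≠ 0 := by exact_mod_cast hα0.ne'
  have hr := neg_I_mul_ne_zero hω
  have hre := (neg_I_mul_re ω).ge
  have h1 := powTail_eq (q := -α) (by linarith) hre hr
  have h2 := integral_zero_one_exp_mul_rpow_of_neg (q := -α) (by linarith) (by linarith) hre hr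
  simp only [exp_neg_neg_I_mul] at h2
  have h3 : (-(Complex.I * (ω : ℂ))) ^ (α : ℂ) =
      -(Complex.I * ω) * (-(Complex.I * (ω : ℂ))) ^ (-(((-α : ℝ) : ℂ) + 1)) := by
    rw [show (α : ℂ) = 1 + -(((-α : ℝ) : ℂ) + 1) by push_cast; ring, Complex.cpow_add _ _ hr,
      Complex.cpow_one]
  have hω' : (ω : ℂ) ≠ 0 := by exact_mod_cast hω.ne'
  rw [regularizedPowIntegral, integral_exp_I_sub_one_mul_rpow hα0 hα1, h2, h3]
  have h4 : powTail (-α - 1) (-(Complex.I * ω)) = (Complex.exp (Complex.I * ω) +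
      Complex.I * ω * powTail (-α) (-(Complex.I * ω))) / α := by
    rw [h1]
    rw [neg_neg]
    push_cast
    field_simp
    ring
  rw [h4, show -α + 1 = 1 - α by ring]
  field_simp
  ring

/-- Dominated convergence applies on `(0, 1]` because the factor `e^{iωt} - 1` is `O(t)`, and on
`(1, ∞)` because `powTail` is absolutely convergent. -/
theorem tendsto_regularizedPowIntegral_zero (ω : ℝ) :
    Tendsto (fun α : ℝ => regularizedPowIntegral α ω) (𝓝[>] 0)
      (𝓝 (regularizedPowIntegral 0 ω)) := by
  have hsmall : ∀ᶠ α : ℝ in 𝓝[>] 0, 0 < α ∧ α < 1 / 2 :=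
    Ioo_mem_nhdsGT (by norm_num : (0 : ℝ) < 1 / 2)
  have hcont : ∀ t : ℝ, 0 < t → ∀ c : ℝ, Tendsto (fun α : ℝ => ((t ^ (-α - c) : ℝ) : ℂ)) (𝓝[>] 0)
      (𝓝 ((t ^ (-0 - c) : ℝ) : ℂ)) := by
    intro t ht c
    have h1 : Continuous fun α : ℝ => t ^ (-α - c) :=
      Continuous.rpow continuous_const (by fun_prop) fun _ => Or.inl ht.ne'
    exact ((Complex.continuous_ofReal.comp h1).tendsto 0).mono_left nhdsWithin_le_nhds
  unfold regularizedPowIntegral powTail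
  refine Tendsto.add ?_ (Tendsto.const_add _ (Tendsto.div_const ?_ _))
  · refine intervalIntegral.tendsto_integral_filter_of_dominated_convergence
      (fun t => |ω| * t ^ (-(1 / 2) : ℝ)) ?_ ?_
      ((intervalIntegral.intervalIntegrable_rpow' (by norm_num)).const_mul _) ?_
    · exact Eventually.of_forall fun α => Measurable.aestronglyMeasurable (by fun_prop)
    · filter_upwards [hsmall] with α hα
      refine Eventually.of_forall fun t ht => ?_
      rw [uIoc_of_le zero_le_one] at ht
      refine (norm_exp_I_sub_one_mul_rpow_le ht.1 _).trans
        (mul_le_mul_of_nonneg_left ?_ (abs_nonneg _))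
      exact Real.rpow_le_rpow_of_exponent_ge ht.1 ht.2 (by linarith [hα.2])
    · refine Eventually.of_forall fun t ht => ?_
      rw [uIoc_of_le zero_le_one] at ht
      exact (hcont t ht.1 1).const_mul _
  · refine tendsto_integral_filter_of_dominated_convergence
      (fun t => 2 * t ^ (-2 : ℝ)) ?_ ?_
      ((integrableOn_Ioi_rpow_of_lt (by norm_num) one_pos).const_mul _) ?_
    · refine Eventually.of_forall fun α => Measurable.aestronglyMeasurable ?_
      simp only [powDeriv_one]
      fun_prop
    · filter_upwards [hsmall] with α hα
      filter_upwards [ae_restrict_mem measurableSet_Ioi] with t ht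
      have ht : 1 < t := ht
      have ht0 : 0 < t := one_pos.trans ht
      rw [norm_mul, Complex.norm_real, powDeriv_one, norm_mul,
        Real.norm_of_nonneg (Real.rpow_nonneg ht0.le _)]
      refine (mul_le_of_le_one_left (by positivity)
        (norm_exp_neg_mul_ofReal_le_one (neg_I_mul_re ω).ge ht0.le)).trans ?_
      refine mul_le_mul ?_ ?_ (Real.rpow_nonneg ht0.le _) (by norm_num)
      · rw [Real.norm_eq_abs, abs_le]
        constructor <;> linarith [hα.1, hα.2]
      · exact Real.rpow_le_rpow_of_exponent_le ht.le (by linarith [hα.1])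
    · filter_upwards [ae_restrict_mem measurableSet_Ioi] with t ht
      have ht0 : 0 < t := one_pos.trans (mem_Ioi.1 ht)
      have h1 : Tendsto (fun α : ℝ => ((-α - 1 : ℝ) : ℂ)) (𝓝[>] 0) (𝓝 ((-0 - 1 : ℝ) : ℂ)) :=
        ((by fun_prop : Continuous fun α : ℝ => ((-α - 1 : ℝ) : ℂ)).tendsto 0).mono_left
          nhdsWithin_le_nhds
      have h2 := (h1.mul (hcont t ht0 2)).const_mul (Complex.exp (-(-(Complex.I * ω) * t)))
      have e : ∀ α : ℝ, ((powDeriv (-α - 1) 1 t : ℝ) : ℂ) =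
          ((-α - 1 : ℝ) : ℂ) * ((t ^ (-α - 2) : ℝ) : ℂ) := by
        intro α
        rw [powDeriv_one, Complex.ofReal_mul, show -α - 1 - 1 = -α - 2 by ring]
      simp only [e]
      exact h2

/-- The value at `α = 0` is the limit of the values for `α > 0`, hence a derivative of the Gamma
function and of a power at the origin. -/
theorem regularizedPowIntegral_zero {ω : ℝ} (hω : 0 < ω) :
    regularizedPowIntegral 0 ω =
      Complex.I * (Real.pi / 2) - Real.eulerMascheroniConstant - Real.log ω := by
  set r : ℂ := -(Complex.I * (ω : ℂ)) with hrdef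
  have hr : r ≠ 0 := neg_I_mul_ne_zero hω
  have hG : HasDerivAt (fun α : ℝ => (Real.Gamma (1 - α) : ℂ))
      (Real.eulerMascheroniConstant : ℂ) 0 := by
    have h := (Real.hasDerivAt_Gamma_one.comp_of_eq (0 : ℝ) ((hasDerivAt_id (0 : ℝ)).const_sub 1)
      (by simp)).ofReal_comp
    refine h.congr_deriv ?_
    simp
  have hP : HasDerivAt (fun α : ℝ => r ^ (α : ℂ)) (Complex.log r) 0 := by
    have h := ((hasDerivAt_id ((0 : ℝ) : ℂ)).const_cpow (c := r) (Or.inl hr)).comp_ofReal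
    refine h.congr_deriv ?_
    simp
  have hD : HasDerivAt (fun α : ℝ => 1 - (Real.Gamma (1 - α) : ℂ) * r ^ (α : ℂ))
      (-(Real.eulerMascheroniConstant + Complex.log r)) 0 := by
    have h := (hG.mul hP).const_sub 1
    refine h.congr_deriv ?_
    simp
  have hlim := (hasDerivAt_iff_tendsto_slope.1 hD).mono_left
    (nhdsWithin_mono (0 : ℝ) (fun x (hx : 0 < x) => hx.ne'))
  have hval : -((Real.eulerMascheroniConstant : ℂ) + Complex.log r) =
      Complex.I * (Real.pi / 2) - Real.eulerMascheroniConstant - Real.log ω := by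
    rw [hrdef, log_neg_I_mul hω]
    ring
  rw [← hval]
  refine tendsto_nhds_unique (tendsto_regularizedPowIntegral_zero ω) (hlim.congr' ?_)
  filter_upwards [Ioo_mem_nhdsGT (one_pos : (0 : ℝ) < 1)] with α hα
  rw [regularizedPowIntegral_of_pos hα.1 hα.2 hω, slope_def_module]
  simp [hrdef, div_eq_inv_mul]

/-! ### The Fourier integral of a function with a power expansion at the origin -/

theorem isDerivChain_iteratedDeriv {g : ℝ → ℂ} {m : ℕ} (hg : ContDiffOn ℝ m g (Ioi 0)) :
    IsDerivChain (fun k => iteratedDeriv k g) m := by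
  refine ⟨fun k hk t ht => ?_, ?_⟩
  · have h := hg.differentiableOn_iteratedDerivWithin (m := k) (by exact_mod_cast hk)
      isOpen_Ioi.uniqueDiffOn
    have h1 : DifferentiableOn ℝ (iteratedDeriv k g) (Ioi 0) :=
      h.congr fun x hx => (iteratedDerivWithin_of_isOpen isOpen_Ioi hx).symm
    have h2 := (h1.differentiableAt (isOpen_Ioi.mem_nhds ht)).hasDerivAt
    simpa only [iteratedDeriv_succ] using h2
  · have h := hg.continuousOn_iteratedDerivWithin (m := m) le_rfl isOpen_Ioi.uniqueDiffOn
    exact h.congr fun x hx => (iteratedDerivWithin_of_isOpen isOpen_Ioi hx).symm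

theorem contDiffOn_fTilde {f : ℝ → ℂ} {m : ℕ} (hf : ContDiffOn ℝ m f (Ioi 0)) (a₀ : ℂ) (α : ℝ) :
    ContDiffOn ℝ m (fTilde f a₀ α) (Ioi 0) := by
  have h1 : ContDiffOn ℝ m (fun t : ℝ => ((t ^ (-α) : ℝ) : ℂ)) (Ioi 0) := fun t ht =>
    (Complex.ofRealCLM.contDiff.contDiffAt.comp t
      (Real.contDiffAt_rpow_const_of_ne (ne_of_gt ht))).contDiffWithinAt
  have h2 : ContDiffOn ℝ m (fun t : ℝ => (t : ℂ)) (Ioi 0) :=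
    Complex.ofRealCLM.contDiff.contDiffOn
  have h3 := (hf.sub (contDiffOn_const (c := a₀).mul h1)).mul
    (h2.inv fun t ht => by exact_mod_cast (ne_of_gt ht))
  exact h3.congr fun t _ => div_eq_mul_inv _ _

/-- The Leibniz rule for the derivatives of `t * h(t)`. -/
theorem IsDerivChain.mul_succ_of_mul_eq {h F : ℕ → ℝ → ℂ} {m : ℕ} (H : IsDerivChain h m)
    (HF : IsDerivChain F m) (h0 : ∀ t : ℝ, 0 < t → t * h 0 t = F 0 t) {k : ℕ} (hk : k + 1 ≤ m) :
    ∀ t : ℝ, 0 < t → t * h (k + 1) t + (k + 1) * h k t = F (k + 1) t := by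
  have hid : ∀ t : ℝ, HasDerivAt (fun t : ℝ => (t : ℂ)) 1 t := fun t =>
    Complex.ofRealCLM.hasDerivAt
  induction k with
  | zero =>
    intro t ht
    have h1 := (hid t).mul (H.hasDerivAt 0 hk t ht)
    have h2 := (HF.hasDerivAt 0 hk t ht).congr_of_eventuallyEq
      ((eventually_gt_nhds ht).mono h0)
    have h3 := h1.unique h2
    rw [← h3]
    push_cast
    ring
  | succ k ih =>
    intro t ht
    have h1 := ((hid t).mul (H.hasDerivAt (k + 1) hk t ht)).add
      ((H.hasDerivAt k (by omega) t ht).const_mul ((k : ℂ) + 1))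
    have h2 := (HF.hasDerivAt (k + 1) hk t ht).congr_of_eventuallyEq
      ((eventually_gt_nhds ht).mono (ih (by omega)))
    have h3 := h1.unique h2
    rw [← h3]
    push_cast
    ring

/-- Division by `t` lowers the order of vanishing at the origin of all derivatives by one. -/
theorem IsDerivChain.isBigO_of_mul_eq {h F : ℕ → ℝ → ℂ} {m : ℕ} (H : IsDerivChain h m)
    (HF : IsDerivChain F m) (h0 : ∀ t : ℝ, 0 < t → t * h 0 t = F 0 t) {β : ℝ}
    (hF : ∀ k ≤ m, F k =O[𝓝[>] (0 : ℝ)] fun t : ℝ => t ^ (β + 1 - k)) {k : ℕ} (hk : k ≤ m) :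
    h k =O[𝓝[>] (0 : ℝ)] fun t : ℝ => t ^ (β - k) := by
  have hdiv : ∀ (j : ℕ) {u : ℝ → ℂ}, (fun t : ℝ => (t : ℂ) * u t) =O[𝓝[>] (0 : ℝ)]
      (fun t : ℝ => t ^ (β + 1 - j)) → u =O[𝓝[>] (0 : ℝ)] fun t : ℝ => t ^ (β - j) := by
    intro j u hu
    have h1 := (isBigO_refl (fun t : ℝ => t⁻¹) (𝓝[>] (0 : ℝ))).norm_left.mul hu.norm_left
    refine (IsBigO.of_norm_left (h1.congr' ?_ ?_))
    · filter_upwards [self_mem_nhdsWithin] with t ht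
      have ht : 0 < t := ht
      rw [norm_mul, Complex.norm_real, norm_inv, inv_mul_cancel_left₀ (norm_ne_zero_iff.2 ht.ne')]
    · filter_upwards [self_mem_nhdsWithin] with t ht
      have ht : 0 < t := ht
      rw [show β + 1 - j = β - j + 1 by ring, Real.rpow_add_one ht.ne']
      field_simp
  induction k with
  | zero =>
    refine hdiv 0 ((hF 0 hk).congr' ?_ .rfl)
    filter_upwards [self_mem_nhdsWithin] with t ht
    exact (h0 t ht).symm
  | succ k ih =>
    have h1 := (ih (by omega)).const_mul_left ((k : ℂ) + 1)
    have h2 := hF (k + 1) hk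
    have e : β + 1 - (k + 1 : ℕ) = β - k := by push_cast; ring
    refine hdiv (k + 1) ?_
    rw [e] at h2 ⊢
    refine (h2.sub h1).congr' ?_ .rfl
    filter_upwards [self_mem_nhdsWithin] with t ht
    rw [← H.mul_succ_of_mul_eq HF h0 hk t ht]
    ring

theorem intervalIntegrable_of_isBigO_rpow {h : ℝ → ℂ} (hc : ContinuousOn h (Ioi 0)) {β : ℝ}
    (hβ : -1 < β) (hO : h =O[𝓝[>] (0 : ℝ)] fun t : ℝ => t ^ β) :
    IntervalIntegrable h volume 0 1 := by
  obtain ⟨C, hC⟩ := hO.bound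
  obtain ⟨δ, hδ, hδs⟩ := mem_nhdsGT_iff_exists_Ioc_subset.1 hC
  have hδ : 0 < δ := hδ
  refine IntervalIntegrable.trans (b := δ) ?_
    (intervalIntegrable_of_continuousOn_Ioi hc hδ one_pos)
  rw [intervalIntegrable_iff_integrableOn_Ioc_of_le hδ.le]
  have h1 := (intervalIntegral.intervalIntegrable_rpow' (a := 0) (b := δ) hβ).const_mul C
  rw [intervalIntegrable_iff_integrableOn_Ioc_of_le hδ.le] at h1
  refine Integrable.mono' h1
    ((hc.mono Ioc_subset_Ioi_self).aestronglyMeasurable measurableSet_Ioc) ?_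
  filter_upwards [ae_restrict_mem measurableSet_Ioc] with t ht
  have := hδs ht
  simp only [mem_ofPred_eq] at this
  rwa [Real.norm_of_nonneg (Real.rpow_nonneg ht.1.le _)] at this

theorem tendsto_rpow_nhdsGT_zero {β : ℝ} (hβ : 0 < β) :
    Tendsto (fun t : ℝ => t ^ β) (𝓝[>] 0) (𝓝 0) := by
  have := (Real.continuousAt_rpow_const 0 β (Or.inr hβ.le)).tendsto
  rw [Real.zero_rpow hβ.ne'] at this
  exact this.mono_left nhdsWithin_le_nhds

/-- The `m`-th derivative of `t ^ (l - 1 - α)`, `l ≤ m`, is integrable at infinity. In the borderline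
case `l = m`, `α = 0` it vanishes identically. -/
theorem integrableOn_powDeriv_of_le {α : ℝ} (hα0 : 0 ≤ α) {l m : ℕ} (hl1 : 1 ≤ l) (hlm : l ≤ m) :
    IntegrableOn (fun t : ℝ => (powDeriv (l - 1 - α) m t : ℂ)) (Ioi 1) := by
  have hlm' : (l : ℝ) ≤ m := by exact_mod_cast hlm
  by_cases h : (l : ℝ) - 1 - α - m < -1
  · exact integrableOn_powDeriv h
  · have hα : α = 0 := by linarith
    have hl : (l : ℝ) = m := by linarith
    have hz : ∀ t : ℝ, powDeriv (l - 1 - α) m t = 0 := by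
      intro t
      rw [powDeriv, Finset.prod_eq_zero (i := m - 1) (Finset.mem_range.2 (by omega)), zero_mul]
      rw [hα, hl, Nat.cast_sub (by omega)]
      simp
    simp [hz]

theorem norm_neg_I_mul {ω : ℝ} (hω : 0 < ω) : ‖-(Complex.I * (ω : ℂ))‖ = ω := by
  simp [abs_of_pos hω]

/-- The sum `∑_{l=1}^m a_l t ^ (l - 1 - α)`, together with its derivatives. -/
noncomputable def powSum (a : ℕ → ℂ) (α : ℝ) (m k : ℕ) (t : ℝ) : ℂ :=
  ∑ l ∈ Finset.Icc 1 m, a l * (powDeriv (l - 1 - α) k t : ℂ)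

theorem isDerivChain_powSum (a : ℕ → ℂ) (α : ℝ) (m n : ℕ) : IsDerivChain (powSum a α m) n :=
  IsDerivChain.sum _ fun _ _ => (isDerivChain_powDeriv _ n).const_mul _

/-- The Gamma terms of the expansion, minus the boundary terms at `1` and a remainder of the form
`r ^ (-m)` times a Fourier integral of integrable functions. -/
theorem integral_exp_mul_powSum (a : ℕ → ℂ) {α : ℝ} (hα0 : 0 ≤ α) (hα1 : α < 1) (m : ℕ) {r : ℂ}
    (hr : 0 ≤ r.re) (hr0 : r ≠ 0) :
    IntervalIntegrable (powSum a α m 0) volume 0 1 ∧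
    ∫ t in (0 : ℝ)..1, Complex.exp (-(r * t)) * powSum a α m 0 t =
      ∑ l ∈ Finset.Icc 1 m, a l * (Real.Gamma (l - α) * r ^ (-((l - α : ℝ) : ℂ))) -
        ∑ k ∈ Finset.range m, Complex.exp (-r) * powSum a α m k 1 / r ^ (k + 1) -
        (∑ l ∈ Finset.Icc 1 m, a l * ∫ t in Ioi (1 : ℝ),
          Complex.exp (-(r * t)) * (powDeriv (l - 1 - α) m t : ℂ)) / r ^ m := by
  have hq : ∀ l ∈ Finset.Icc 1 m, (-1 : ℝ) < l - 1 - α := by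
    intro l hl
    have : (1 : ℝ) ≤ l := by exact_mod_cast (Finset.mem_Icc.1 hl).1
    linarith
  have hi : ∀ l ∈ Finset.Icc 1 m, IntervalIntegrable
      (fun t : ℝ => a l * (powDeriv (l - 1 - α) 0 t : ℂ)) volume 0 1 := by
    intro l hl
    simp only [powDeriv_zero]
    exact (intervalIntegrable_ofReal_rpow (hq l hl)).const_mul _
  have hsum : IntervalIntegrable (powSum a α m 0) volume 0 1 := by
    have := IntervalIntegrable.sum (Finset.Icc 1 m) hi
    refine this.congr fun t _ => ?_
    simp [powSum]
  refine ⟨hsum, ?_⟩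
  have e1 : ∀ t : ℝ, Complex.exp (-(r * t)) * powSum a α m 0 t = ∑ l ∈ Finset.Icc 1 m,
      Complex.exp (-(r * t)) * (a l * (powDeriv (l - 1 - α) 0 t : ℂ)) := fun t => by
    rw [powSum, Finset.mul_sum]
  simp only [e1]
  rw [intervalIntegral.integral_finsetSum fun l hl => intervalIntegrable_exp_mul (hi l hl) r]
  have e2 : ∀ l ∈ Finset.Icc 1 m, ∫ t in (0 : ℝ)..1,
      Complex.exp (-(r * t)) * (a l * (powDeriv (l - 1 - α) 0 t : ℂ)) =
      a l * (Real.Gamma (l - α) * r ^ (-((l - α : ℝ) : ℂ))) -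
      ∑ k ∈ Finset.range m, Complex.exp (-r) * (a l * powDeriv (l - 1 - α) k 1) / r ^ (k + 1) -
      (a l * ∫ t in Ioi (1 : ℝ), Complex.exp (-(r * t)) * (powDeriv (l - 1 - α) m t : ℂ)) /
        r ^ m := by
    intro l hl
    have h := integral_zero_one_exp_mul_rpow (hq l hl)
      (integrableOn_powDeriv_of_le hα0 (Finset.mem_Icc.1 hl).1 (Finset.mem_Icc.1 hl).2) hr hr0
    have e3 : ∀ t : ℝ, Complex.exp (-(r * t)) * (a l * (powDeriv (l - 1 - α) 0 t : ℂ)) =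
        a l * (Complex.exp (-(r * t)) * ((t ^ ((l : ℝ) - 1 - α) : ℝ) : ℂ)) := fun t => by
      rw [powDeriv_zero]
      ring
    simp only [e3]
    rw [intervalIntegral.integral_const_mul, h, show (l : ℝ) - 1 - α + 1 = l - α by ring,
      show -((((l : ℝ) - 1 - α : ℝ) : ℂ) + 1) = -((l - α : ℝ) : ℂ) by push_cast; ring]
    rw [mul_sub, mul_add, Finset.mul_sum, ← sub_sub, mul_div_assoc]
    congr 2
    exact Finset.sum_congr rfl fun k _ => by ring
  rw [Finset.sum_congr rfl e2, Finset.sum_sub_distrib, Finset.sum_sub_distrib, Finset.sum_div]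
  congr 2
  rw [Finset.sum_comm]
  refine Finset.sum_congr rfl fun k _ => ?_
  rw [powSum, Finset.mul_sum, Finset.sum_div]

/-- Uniform convergence allows the limits `R → ∞` and `ω → ∞` to be interchanged, and the
Riemann-Lebesgue lemma applies for each fixed `R`. -/
theorem tendsto_of_tendstoUniformlyOn_fourierTail {g : ℝ → ℂ} {Ω : ℝ} {J : ℝ → ℂ}
    (h : TendstoUniformlyOn (fun (R ω : ℝ) => ∫ t in (1 : ℝ)..R,
      Complex.exp (Complex.I * (ω : ℂ) * (t : ℂ)) * g t) J atTop (Ici Ω)) :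
    Tendsto J atTop (𝓝 0) := by
  have h1 : TendstoUniformlyOnFilter (fun (R ω : ℝ) => ∫ t in (1 : ℝ)..R,
      Complex.exp (Complex.I * (ω : ℂ) * (t : ℂ)) * g t) J atTop atTop :=
    h.tendstoUniformlyOnFilter.mono_right (le_principal_iff.2 (Ici_mem_atTop Ω))
  refine h1.tendsto_of_eventually_tendsto (L := fun _ => 0) ?_ tendsto_const_nhds
  filter_upwards [eventually_ge_atTop 1] with R hR
  simp only [intervalIntegral.integral_of_le hR]
  exact tendsto_setIntegral_exp_mul_atTop g measurableSet_Ioc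

/-- If `g` and its derivatives up to order `m` are approximated at the origin by
`∑_{l=1}^m a_l t ^ (l - 1 - α)` up to an error `O(t ^ (m - α))`, differentiated termwise, and the
Fourier integrals of these derivatives at infinity converge, uniformly for the last one, then the
Fourier integral of `g` has the expansion obtained by termwise integration. -/
theorem IsDerivChain.fourier_isLittleO {g : ℕ → ℝ → ℂ} {m : ℕ} (H : IsDerivChain g m)
    (a : ℕ → ℂ) {α : ℝ} (hα0 : 0 ≤ α) (hα1 : α < 1)
    (hO : ∀ k ≤ m, (fun t => g k t - powSum a α m k t) =O[𝓝[>] (0 : ℝ)]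
      fun t : ℝ => t ^ ((m : ℝ) - α - k)) {Ω : ℝ} {J : ℕ → ℝ → ℂ}
    (hJ : ∀ s ≤ m, ∀ ω : ℝ, Ω ≤ ω → Tendsto (fun R : ℝ =>
      ∫ t in (1 : ℝ)..R, Complex.exp (Complex.I * ω * t) * g s t) atTop (𝓝 (J s ω)))
    (hJm : Tendsto (J m) atTop (𝓝 0)) :
    IntervalIntegrable (g 0) volume 0 1 ∧
    (fun ω : ℝ => (∫ t in (0 : ℝ)..1, Complex.exp (Complex.I * ω * t) * g 0 t) + J 0 ω -
      ∑ l ∈ Finset.Icc 1 m, a l * (Real.Gamma (l - α) *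
        (-(Complex.I * (ω : ℂ))) ^ (-((l - α : ℝ) : ℂ)))) =o[atTop] fun ω : ℝ => ω ^ (-(m : ℝ)) := by
  have hφ : IsDerivChain (fun k t => g k t - powSum a α m k t) m :=
    H.sub (isDerivChain_powSum a α m m)
  have hint : ∀ k ≤ m, IntervalIntegrable (fun t => g k t - powSum a α m k t) volume 0 1 := by
    intro k hk
    have : (k : ℝ) ≤ m := by exact_mod_cast hk
    exact intervalIntegrable_of_isBigO_rpow (hφ.continuousOn hk) (by linarith) (hO k hk)
  have hlim : ∀ k < m, Tendsto (fun t => g k t - powSum a α m k t) (𝓝[>] 0) (𝓝 0) := by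
    intro k hk
    have : (k : ℝ) + 1 ≤ m := by exact_mod_cast hk
    exact (hO k hk.le).trans_tendsto (tendsto_rpow_nhdsGT_zero (by linarith))
  have hg0 : IntervalIntegrable (g 0) volume 0 1 := by
    have h1 := (hint 0 (Nat.zero_le m)).add
      (integral_exp_mul_powSum a hα0 hα1 m (r := 1) (by simp) one_ne_zero).1
    refine h1.congr fun t _ => ?_
    simp
  refine ⟨hg0, ?_⟩
  -- The remainder after `m` integrations by parts, multiplied by `r ^ m` where `r = -iω`.
  set E : ℝ → ℂ := fun ω =>
    (∫ t in Ioc (0 : ℝ) 1, Complex.exp (Complex.I * ω * t) * (g m t - powSum a α m m t)) + J m ω -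
      ∑ l ∈ Finset.Icc 1 m, a l * ∫ t in Ioi (1 : ℝ),
        Complex.exp (Complex.I * ω * t) * (powDeriv (l - 1 - α) m t : ℂ) with hE
  have hE0 : Tendsto E atTop (𝓝 0) := by
    have h1 := tendsto_setIntegral_exp_mul_atTop (fun t => g m t - powSum a α m m t)
      (measurableSet_Ioc (a := (0 : ℝ)) (b := 1))
    have h2 : Tendsto (fun ω : ℝ => ∑ l ∈ Finset.Icc 1 m, a l * ∫ t in Ioi (1 : ℝ),
        Complex.exp (Complex.I * ω * t) * (powDeriv (l - 1 - α) m t : ℂ)) atTop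
        (𝓝 (∑ l ∈ Finset.Icc 1 m, a l * 0)) :=
      tendsto_finsetSum _ fun l _ =>
        (tendsto_setIntegral_exp_mul_atTop _ measurableSet_Ioi).const_mul _
    simpa using (h1.add hJm).sub h2
  have hid : ∀ᶠ ω : ℝ in atTop,
      (∫ t in (0 : ℝ)..1, Complex.exp (Complex.I * ω * t) * g 0 t) + J 0 ω -
      ∑ l ∈ Finset.Icc 1 m, a l * (Real.Gamma (l - α) *
        (-(Complex.I * (ω : ℂ))) ^ (-((l - α : ℝ) : ℂ))) = E ω / (-(Complex.I * (ω : ℂ))) ^ m := by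
    filter_upwards [eventually_gt_atTop 0, eventually_ge_atTop Ω] with ω hω hωΩ
    have hr := neg_I_mul_ne_zero hω
    have h1 := hφ.integral_exp_mul_zero_one hr hlim (hint 0 (Nat.zero_le m)) (hint m le_rfl)
    obtain ⟨h2i, h2⟩ := integral_exp_mul_powSum a hα0 hα1 m (neg_I_mul_re ω).ge hr
    have h3 := H.tendsto_integral_exp_mul hr (J := J m ω) (fun k hk => ?_)
      (by simpa only [exp_neg_neg_I_mul] using hJ m le_rfl ω hωΩ)
    · have h4 : J 0 ω = _ := tendsto_nhds_unique (hJ 0 (Nat.zero_le m) ω hωΩ)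
        (by simpa only [exp_neg_neg_I_mul] using h3)
      have h5 : ∫ t in (0 : ℝ)..1, Complex.exp (-(-(Complex.I * ω) * t)) * g 0 t =
          (∫ t in (0 : ℝ)..1, Complex.exp (-(-(Complex.I * ω) * t)) *
            (g 0 t - powSum a α m 0 t)) +
          ∫ t in (0 : ℝ)..1, Complex.exp (-(-(Complex.I * ω) * t)) * powSum a α m 0 t := by
        rw [← intervalIntegral.integral_add
          (intervalIntegrable_exp_mul (hint 0 (Nat.zero_le m)) _)
          (intervalIntegrable_exp_mul h2i _)]
        refine intervalIntegral.integral_congr fun t _ => ?_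
        ring
      rw [h1, h2] at h5
      simp only [exp_neg_neg_I_mul, mul_sub, sub_div, Finset.sum_sub_distrib] at h5
      rw [h5, h4, hE, intervalIntegral.integral_of_le zero_le_one]
      simp only [mul_sub]
      ring
    · rw [tendsto_zero_iff_norm_tendsto_zero]
      have h0 := H.tendsto_zero_of_tails hJ hk
      rw [tendsto_zero_iff_norm_tendsto_zero] at h0
      refine h0.congr fun R => ?_
      rw [norm_mul, norm_exp_neg_mul_ofReal, neg_I_mul_re]
      simp
  have hbig : (fun ω : ℝ => ((-(Complex.I * (ω : ℂ))) ^ m)⁻¹) =O[atTop]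
      fun ω : ℝ => ω ^ (-(m : ℝ)) := by
    refine IsBigO.of_bound 1 ?_
    filter_upwards [eventually_gt_atTop 0] with ω hω
    rw [norm_inv, norm_pow, norm_neg_I_mul hω, one_mul, Real.rpow_neg hω.le, Real.rpow_natCast,
      Real.norm_of_nonneg (by positivity)]
  have hfin := ((isLittleO_one_iff ℝ).2 hE0).mul_isBigO hbig
  refine hfin.congr' ?_ (Eventually.of_forall fun ω => one_mul _)
  filter_upwards [hid] with ω hω
  rw [hω, div_eq_mul_inv]

/-! ### The finite part -/

/-- The finite part of `∫_0^∞ e^{iωt} F(t) dt` when `F(t) = a₀ t ^ (-α - 1) + g(t)` with `g`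
integrable at the origin. The pair `(p, c)` and the constant `κ` describe the divergent and the
finite part of `∫_ε^1 t ^ (-α - 1) dt`. -/
theorem hasHadamardFinitePart_of_eq_add {F g : ℝ → ℂ} {a₀ J : ℂ} {α ω c κ : ℝ} {p : ℝ × ℕ}
    (hα0 : 0 ≤ α) (hα1 : α < 1) (hω : 0 < ω) (hp : 0 < p.1 ∨ (p.1 = 0 ∧ 1 ≤ p.2))
    (hpow : ∀ ε : ℝ, 0 < ε → ∫ t in ε..1, t ^ (-α - 1) = c * hadamardGauge p ε + κ)
    (hF : ∀ t : ℝ, 0 < t → F t = a₀ * ((t ^ (-α - 1) : ℝ) : ℂ) + g t)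
    (hg : ContinuousOn g (Ioi 0)) (hgi : IntervalIntegrable g volume 0 1)
    (hJ : Tendsto (fun R : ℝ => ∫ t in (1 : ℝ)..R, Complex.exp (Complex.I * ω * t) * g t) atTop
      (𝓝 J)) :
    HasHadamardFinitePart (fun t : ℝ => Complex.exp (Complex.I * ω * t) * F t)
      (a₀ * (regularizedPowIntegral α ω + κ) +
        ((∫ t in (0 : ℝ)..1, Complex.exp (Complex.I * ω * t) * g t) + J)) := by
  have hpc : ContinuousOn (fun t : ℝ => ((t ^ (-α - 1) : ℝ) : ℂ)) (Ioi 0) := by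
    simpa only [powDeriv_zero] using continuousOn_ofReal_powDeriv (-α - 1) 0
  have hec : Continuous fun t : ℝ => Complex.exp (Complex.I * ω * t) := by fun_prop
  have hFc : ContinuousOn F (Ioi 0) := ((continuousOn_const.mul hpc).add hg).congr hF
  have hIc : ContinuousOn (fun t : ℝ => Complex.exp (Complex.I * ω * t) * F t) (Ioi 0) :=
    hec.continuousOn.mul hFc
  have hgc : ContinuousOn (fun t : ℝ => Complex.exp (Complex.I * ω * t) * g t) (Ioi 0) :=
    hec.continuousOn.mul hg
  have hepc : ContinuousOn (fun t : ℝ => Complex.exp (Complex.I * ω * t) *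
      ((t ^ (-α - 1) : ℝ) : ℂ)) (Ioi 0) := hec.continuousOn.mul hpc
  refine ⟨1, one_pos, a₀ * ((∫ t in (0 : ℝ)..1, (Complex.exp (Complex.I * ω * t) - 1) *
      ((t ^ (-α - 1) : ℝ) : ℂ)) + κ) + ∫ t in (0 : ℝ)..1, Complex.exp (Complex.I * ω * t) * g t,
    a₀ * powTail (-α - 1) (-(Complex.I * ω)) + J, ⟨fun ε hε =>
      intervalIntegrable_of_continuousOn_Ioi hIc hε one_pos, {p}, fun _ => a₀ * c, ?_, ?_⟩,
    ⟨fun R hR => intervalIntegrable_of_continuousOn_Ioi hIc one_pos (one_pos.trans_le hR), ?_⟩, ?_⟩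
  · intro p' hp'
    rw [Finset.mem_singleton] at hp'
    rwa [hp']
  · have h1 := tendsto_integral_left_endpoint
      (intervalIntegrable_exp_I_sub_one_mul_rpow ω (q := -α - 1) (by linarith))
    have hgi' : IntervalIntegrable (fun t : ℝ => Complex.exp (Complex.I * ω * t) * g t)
        volume 0 1 := hgi.continuousOn_mul hec.continuousOn
    have h2 := tendsto_integral_left_endpoint hgi'
    refine (((h1.add_const (κ : ℂ)).const_mul a₀).add h2).congr' ?_
    filter_upwards [self_mem_nhdsWithin] with ε hε
    have hε : 0 < ε := hε
    have hi1 := intervalIntegrable_of_continuousOn_Ioi hpc hε one_pos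
    have hi2 := intervalIntegrable_of_continuousOn_Ioi hepc hε one_pos
    have hi3 := intervalIntegrable_of_continuousOn_Ioi hgc hε one_pos
    have e1 : ∫ t in ε..1, Complex.exp (Complex.I * ω * t) * F t =
        a₀ * (∫ t in ε..1, Complex.exp (Complex.I * ω * t) * ((t ^ (-α - 1) : ℝ) : ℂ)) +
          ∫ t in ε..1, Complex.exp (Complex.I * ω * t) * g t := by
      rw [← intervalIntegral.integral_const_mul,
        ← intervalIntegral.integral_add (hi2.const_mul _) hi3]
      refine intervalIntegral.integral_congr fun t ht => ?_
      simp only [hF t (uIcc_subset_Ioi_zero hε one_pos ht)]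
      ring
    have e2 : ∫ t in ε..1, (Complex.exp (Complex.I * ω * t) - 1) * ((t ^ (-α - 1) : ℝ) : ℂ) =
        (∫ t in ε..1, Complex.exp (Complex.I * ω * t) * ((t ^ (-α - 1) : ℝ) : ℂ)) -
          ((c * hadamardGauge p ε + κ : ℝ) : ℂ) := by
      rw [← hpow ε hε, ← intervalIntegral.integral_ofReal, ← intervalIntegral.integral_sub hi2 hi1]
      refine intervalIntegral.integral_congr fun t _ => ?_
      ring
    rw [e1, e2, Finset.sum_singleton]
    push_cast
    ring
  · have h1 := tendsto_integral_exp_mul_rpow (q := -α - 1) (by linarith) (neg_I_mul_re ω).ge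
      (neg_I_mul_ne_zero hω)
    simp only [exp_neg_neg_I_mul] at h1
    refine ((h1.const_mul a₀).add hJ).congr' ?_
    filter_upwards [eventually_gt_atTop 0] with R hR
    rw [← intervalIntegral.integral_const_mul, ← intervalIntegral.integral_add
      ((intervalIntegrable_of_continuousOn_Ioi hepc one_pos hR).const_mul _)
      (intervalIntegrable_of_continuousOn_Ioi hgc one_pos hR)]
    refine intervalIntegral.integral_congr fun t ht => ?_
    simp only [hF t (uIcc_subset_Ioi_zero one_pos hR ht)]
    ring
  · rw [regularizedPowIntegral]
    ring

theorem integral_rpow_neg_sub_one {α ε : ℝ} (hα : 0 < α) (hε : 0 < ε) :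
    ∫ t in ε..1, t ^ (-α - 1) = 1 / α * hadamardGauge (α, 0) ε + -(1 / α) := by
  rw [integral_rpow (Or.inr ⟨by linarith, fun h => ?_⟩)]
  · simp [hadamardGauge]
    field_simp
    ring
  · exact lt_irrefl (0 : ℝ) (uIcc_subset_Ioi_zero hε one_pos h)

theorem integral_rpow_neg_zero_sub_one {ε : ℝ} (hε : 0 < ε) :
    ∫ t in ε..1, t ^ (-(0 : ℝ) - 1) = -1 * hadamardGauge (0, 1) ε + 0 := by
  have e : ∀ t : ℝ, t ^ (-(0 : ℝ) - 1) = t⁻¹ := fun t => by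
    rw [neg_zero, zero_sub, Real.rpow_neg_one]
  simp only [e]
  rw [integral_inv_of_pos hε one_pos]
  simp [hadamardGauge]

/-- Termwise differentiability of the expansion of `f` yields the behaviour at the origin of the
derivatives of `fTilde f (a 0) α`. -/
theorem isBigO_iteratedDeriv_fTilde {f : ℝ → ℂ} {a : ℕ → ℂ} {α : ℝ} {m : ℕ}
    (hdiff : ContDiffOn ℝ m f (Ioi 0)) (hexp : HasDifferentiableExpansionAtZero f a α m)
    {k : ℕ} (hk : k ≤ m) :
    (fun t => iteratedDeriv k (fTilde f (a 0) α) t - powSum a α m k t) =O[𝓝[>] (0 : ℝ)]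
      fun t : ℝ => t ^ ((m : ℝ) - α - k) := by
  have hterm : ∀ (j s : ℕ) (t : ℝ),
      a j * ((∏ i ∈ Finset.range s, ((j : ℝ) - α - (i : ℝ)) : ℝ) : ℂ) *
        ((t ^ ((j : ℝ) - (α + s)) : ℝ) : ℂ) = a j * (powDeriv (j - α) s t : ℂ) := by
    intro j s t
    rw [powDeriv, Complex.ofReal_mul, mul_assoc, sub_sub (j : ℝ) α s]
  have hψ : IsDerivChain (fun k t => iteratedDeriv k f t -
      ∑ j ∈ Finset.range (m + 1), a j * (powDeriv (j - α) k t : ℂ)) m :=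
    (isDerivChain_iteratedDeriv hdiff).sub
      (IsDerivChain.sum _ fun _ _ => (isDerivChain_powDeriv _ m).const_mul _)
  have hφ : IsDerivChain (fun k t => iteratedDeriv k (fTilde f (a 0) α) t - powSum a α m k t) m :=
    (isDerivChain_iteratedDeriv (contDiffOn_fTilde hdiff _ _)).sub (isDerivChain_powSum a α m m)
  refine hφ.isBigO_of_mul_eq hψ (β := (m : ℝ) - α) ?_ ?_ hk
  · intro t ht
    have ht' : (t : ℂ) ≠ 0 := by exact_mod_cast ht.ne'
    have hpow : ∀ l : ℕ, (t : ℂ) * (a l * (powDeriv (l - 1 - α) 0 t : ℂ)) =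
        a l * (powDeriv (l - α) 0 t : ℂ) := by
      intro l
      rw [powDeriv_zero, powDeriv_zero, show (l : ℝ) - α = l - 1 - α + 1 by ring,
        Real.rpow_add_one ht.ne']
      push_cast
      ring
    simp only [iteratedDeriv_zero, powSum, fTilde]
    rw [mul_sub, mul_div_cancel₀ _ ht', Finset.mul_sum, Finset.sum_congr rfl fun l _ => hpow l,
      Finset.range_eq_Ico, Finset.sum_eq_sum_Ico_succ_bot (by omega : 0 < m + 1),
      zero_add, Finset.Ico_add_one_right_eq_Icc, powDeriv_zero]
    simp only [Nat.cast_zero, zero_sub]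
    ring
  · intro s hs
    -- The expansion one order further, whose last term is then estimated separately.
    have h1 := (hexp s hs (m + 1)).isBigO
    simp only [hterm] at h1
    have h2 : (fun t : ℝ => a (m + 1) * (powDeriv ((m + 1 : ℕ) - α) s t : ℂ)) =O[𝓝[>] (0 : ℝ)]
        fun t : ℝ => t ^ (((m + 1 : ℕ) : ℝ) - (α + s)) := by
      refine IsBigO.const_mul_left (IsBigO.of_norm_left ?_) _
      simp only [Complex.norm_real, powDeriv, sub_sub]
      exact (isBigO_const_mul_self _ _ _).norm_left
    have e : (m : ℝ) - α + 1 - s = ((m + 1 : ℕ) : ℝ) - (α + s) := by push_cast; ring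
    rw [e]
    refine (h1.add h2).congr_left fun t => ?_
    rw [Finset.sum_range_succ _ (m + 1)]
    ring

theorem mainTheorem2 (f : ℝ → ℂ) (a : ℕ → ℂ) (α : ℝ) (m : ℕ)
    (hα0 : 0 ≤ α) (hα1 : α < 1) (hm : 1 ≤ m)
    (hloc : LocallyIntegrableOn f (Ici 0))
    (hdiff : ContDiffOn ℝ m f (Ioi 0))
    (hexp : HasDifferentiableExpansionAtZero f a α m)
    (hf0 : α = 0 → ContinuousWithinAt f (Ici 0) 0)
    (htail : ∀ s : ℕ, s ≤ m →
      FourierTailConvergesUniformly (iteratedDeriv s (fTilde f (a 0) α))) :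
    (∀ᶠ ω : ℝ in atTop, ∃ L : ℂ, HasHadamardFinitePart
      (fun t : ℝ => Complex.exp (Complex.I * (ω : ℂ) * (t : ℂ)) * (f t / (t : ℂ))) L) ∧
    (0 < α →
      (fun ω : ℝ =>
        hadamardFinitePart
          (fun t : ℝ => Complex.exp (Complex.I * (ω : ℂ) * (t : ℂ)) * (f t / (t : ℂ))) -
        (Complex.exp ((Real.pi : ℂ) / 2 * (2 - (α : ℂ)) * Complex.I) *
            ((ω ^ α / α * Real.Gamma (1 - α) : ℝ) : ℂ) * a 0 +
          ∑ l ∈ Finset.Icc 1 m,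
            a l * Complex.exp ((Real.pi : ℂ) / 2 * ((l : ℂ) - (α : ℂ)) * Complex.I) *
              ((Real.Gamma ((l : ℝ) - α) / ω ^ ((l : ℝ) - α) : ℝ) : ℂ)))
        =o[atTop] fun ω : ℝ => ω ^ (-(m : ℝ))) ∧
    (α = 0 →
      (fun ω : ℝ =>
        hadamardFinitePart
          (fun t : ℝ => Complex.exp (Complex.I * (ω : ℂ) * (t : ℂ)) * (f t / (t : ℂ))) -
        ((Complex.I * ((Real.pi : ℂ) / 2) - (Real.eulerMascheroniConstant : ℂ) -
              (Real.log ω : ℂ)) * f 0 +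
          ∑ l ∈ Finset.Icc 1 m,
            a l * Complex.exp ((Real.pi : ℂ) * (l : ℂ) / 2 * Complex.I) *
              ((((l - 1).factorial : ℝ) / ω ^ l : ℝ) : ℂ)))
        =o[atTop] fun ω : ℝ => ω ^ (-(m : ℝ))) := by
  choose! Ω J hU using htail
  -- A common threshold for the frequencies of the tails of all orders.
  set Ω₀ : ℝ := ∑ s ∈ Finset.range (m + 1), |Ω s| with hΩ₀
  have hΩ : ∀ s ≤ m, Ω s ≤ Ω₀ := fun s hs => (le_abs_self _).trans
    (Finset.single_le_sum (f := fun s => |Ω s|) (fun i _ => abs_nonneg _)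
      (Finset.mem_range.2 (by omega)))
  have hcomm : ∀ (s : ℕ) (ω t : ℝ), iteratedDeriv s (fTilde f (a 0) α) t *
      Complex.exp (Complex.I * (ω : ℂ) * (t : ℂ)) =
      Complex.exp (Complex.I * ω * t) * iteratedDeriv s (fTilde f (a 0) α) t :=
    fun s ω t => mul_comm _ _
  simp only [hcomm] at hU
  have hJ : ∀ s ≤ m, ∀ ω : ℝ, Ω₀ ≤ ω → Tendsto (fun R : ℝ => ∫ t in (1 : ℝ)..R,
      Complex.exp (Complex.I * ω * t) * iteratedDeriv s (fTilde f (a 0) α) t) atTop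
      (𝓝 (J s ω)) :=
    fun s hs ω hω => (hU s hs).tendsto_at ((hΩ s hs).trans hω : ω ∈ Ici (Ω s))
  have hJm := tendsto_of_tendstoUniformlyOn_fourierTail (hU m le_rfl)
  have hchain := isDerivChain_iteratedDeriv (contDiffOn_fTilde hdiff (a 0) α)
  obtain ⟨hgi, hlittle⟩ := hchain.fourier_isLittleO a hα0 hα1
    (fun k hk => isBigO_iteratedDeriv_fTilde hdiff hexp hk) hJ hJm
  have hF : ∀ t : ℝ, 0 < t → f t / (t : ℂ) =
      a 0 * ((t ^ (-α - 1) : ℝ) : ℂ) + iteratedDeriv 0 (fTilde f (a 0) α) t := by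
    intro t ht
    have ht' : (t : ℂ) ≠ 0 := by exact_mod_cast ht.ne'
    rw [iteratedDeriv_zero, fTilde, Real.rpow_sub_one ht.ne']
    push_cast
    field_simp
    ring
  have hFP : ∀ (p : ℝ × ℕ) (c κ : ℝ), (0 < p.1 ∨ (p.1 = 0 ∧ 1 ≤ p.2)) →
      (∀ ε : ℝ, 0 < ε → ∫ t in ε..1, t ^ (-α - 1) = c * hadamardGauge p ε + κ) →
      ∀ᶠ ω : ℝ in atTop, HasHadamardFinitePart
        (fun t : ℝ => Complex.exp (Complex.I * (ω : ℂ) * (t : ℂ)) * (f t / (t : ℂ)))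
        (a 0 * (regularizedPowIntegral α ω + κ) + ((∫ t in (0 : ℝ)..1,
          Complex.exp (Complex.I * ω * t) * iteratedDeriv 0 (fTilde f (a 0) α) t) + J 0 ω)) := by
    intro p c κ hp hpow
    filter_upwards [eventually_gt_atTop 0, eventually_ge_atTop Ω₀] with ω hω hωΩ
    exact hasHadamardFinitePart_of_eq_add hα0 hα1 hω hp hpow hF
      (hchain.continuousOn (Nat.zero_le m)) hgi (hJ 0 (Nat.zero_le m) ω hωΩ)
  have hFPpos := fun h : 0 < α => hFP (α, 0) (1 / α) (-(1 / α)) (Or.inl h)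
    fun ε hε => integral_rpow_neg_sub_one h hε
  have hFPzero := fun h : α = 0 => hFP (0, 1) (-1) 0 (Or.inr ⟨rfl, le_rfl⟩)
    fun ε hε => by rw [h]; exact integral_rpow_neg_zero_sub_one hε
  refine ⟨?_, fun hα => ?_, fun hα => ?_⟩
  · rcases hα0.lt_or_eq with h | h
    · exact (hFPpos h).mono fun ω hω => ⟨_, hω⟩
    · exact (hFPzero h.symm).mono fun ω hω => ⟨_, hω⟩
  · refine hlittle.congr' ?_ .rfl
    filter_upwards [hFPpos hα, eventually_gt_atTop 0] with ω h hω
    have hsum : ∀ l ∈ Finset.Icc 1 m, a l * (Real.Gamma (l - α) *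
        (-(Complex.I * (ω : ℂ))) ^ (-((l - α : ℝ) : ℂ))) =
        a l * Complex.exp ((Real.pi : ℂ) / 2 * ((l : ℂ) - (α : ℂ)) * Complex.I) *
          ((Real.Gamma ((l : ℝ) - α) / ω ^ ((l : ℝ) - α) : ℝ) : ℂ) := by
      intro l _
      rw [← Complex.ofReal_neg, neg_I_mul_cpow hω, Real.rpow_neg hω.le]
      push_cast
      rw [show -((Real.pi : ℂ) / 2 * -((l : ℂ) - α) * Complex.I) =
        (Real.pi : ℂ) / 2 * ((l : ℂ) - α) * Complex.I by ring]
      ring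
    have hα' : (α : ℂ) ≠ 0 := by exact_mod_cast hα.ne'
    have hexp2 : Complex.exp ((Real.pi : ℂ) / 2 * (2 - (α : ℂ)) * Complex.I) =
        -Complex.exp (-((Real.pi : ℂ) / 2 * α * Complex.I)) := by
      rw [show (Real.pi : ℂ) / 2 * (2 - (α : ℂ)) * Complex.I =
        Real.pi * Complex.I + -((Real.pi : ℂ) / 2 * α * Complex.I) by ring, Complex.exp_add,
        Complex.exp_pi_mul_I]
      ring
    rw [h.eq, Finset.sum_congr rfl hsum, regularizedPowIntegral_of_pos hα hα1 hω,
      neg_I_mul_cpow hω, hexp2]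
    push_cast
    field_simp
    ring
  · refine hlittle.congr' ?_ .rfl
    have hf00 : f 0 = a 0 := by
      have h1 : Tendsto f (𝓝[>] 0) (𝓝 (f 0)) :=
        (hf0 hα).tendsto.mono_left (nhdsWithin_mono _ Ioi_subset_Ici_self)
      have h2 := hexp 0 (Nat.zero_le m) 0
      simp only [hα, zero_add, Finset.range_one, Finset.sum_singleton, Finset.range_zero,
        Finset.prod_empty, Complex.ofReal_one, mul_one, iteratedDeriv_zero, Nat.cast_zero,
        sub_zero, Real.rpow_zero] at h2
      have h3 := ((isLittleO_one_iff ℝ).1 h2).add_const (a 0)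
      simp only [sub_add_cancel, zero_add] at h3
      exact tendsto_nhds_unique h1 h3
    filter_upwards [hFPzero hα, eventually_gt_atTop 0] with ω h hω
    have hsum : ∀ l ∈ Finset.Icc 1 m, a l * (Real.Gamma (l - α) *
        (-(Complex.I * (ω : ℂ))) ^ (-((l - α : ℝ) : ℂ))) =
        a l * Complex.exp ((Real.pi : ℂ) * (l : ℂ) / 2 * Complex.I) *
          ((((l - 1).factorial : ℝ) / ω ^ l : ℝ) : ℂ) := by
      intro l hl
      obtain ⟨n, rfl⟩ : ∃ n, l = n + 1 := ⟨l - 1, by have := (Finset.mem_Icc.1 hl).1; omega⟩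
      rw [hα, sub_zero, ← Complex.ofReal_neg, neg_I_mul_cpow hω, Real.rpow_neg hω.le,
        Real.rpow_natCast, Nat.add_sub_cancel, Nat.cast_add_one, Real.Gamma_nat_eq_factorial]
      push_cast
      rw [show -((Real.pi : ℂ) / 2 * -((n : ℂ) + 1) * Complex.I) =
        (Real.pi : ℂ) * ((n : ℂ) + 1) / 2 * Complex.I by ring]
      ring
    rw [h.eq, Finset.sum_congr rfl hsum, hα, regularizedPowIntegral_zero hω, hf00]
    push_cast
    ring
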